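/- For a probability measure $\mu$ on $\mathbb{R}$ let $G_\mu(z)=\int \frac{1}{z-x}\,d\mu(x)$ and $K_\mu(z)=z-1/G_\mu(z)$ for $\operatorname{Im} z>0$. The Boolean convolution $\mu\uplus\nu$ of two probability measures is the unique probability measure with $K_{\mu\uplus\nu}=K_\mu+K_\nu$ on the upper half-plane, and $\mu^{\uplus n}$ is the $n$-fold Boolean convolution of $\mu$ with itself. For a probability measure $\mu$ with finite second moment, the Boolean entropy relative to the Rademacher law $\mathrm{b}=\frac12\delta_{-1}+\frac12\delta_{1}$ is $$\Gamma(\mu|\mathrm{b})=\frac12\int x^2\,d\mu(x)-\int\log|x|\,d\mu(x)-\frac12\in[0,+\infty],$$ where $\log 0=-\infty$. Let $\mu$ be a symmetric probability measure on $\mathbb{R}$ with $\int x^2\,d\mu=1$, $\int x^4\,d\mu<\infty$ and $\int x^{-2}\,d\mu<\infty$ (the last condition includes $\mu(\{0\})=0$). For $n\ge 1$ let $\mu_n$ be the dilation of $\mu^{\uplus n}$ by $1/\sqrt n$, i.e. $\mu_n(B)=\mu^{\uplus n}(\{x: x/\sqrt n\in B\})$. Then $0\le\Gamma(\mu_n|\mathrm{b})<\infty$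 for every $n\ge1$ and, as $n\to\infty$, $$\Gamma(\mu_n|\mathrm{b})=O\!\left(\frac{\log n}{n}\right),$$ with an implied constant that may depend on $\mu$. -/

import Mathlib

open MeasureTheory Filter Asymptotics
open scoped ENNReal

namespace BooleanProb

noncomputable section

/-- The Cauchy transform `G_μ(z) = ∫ 1/(z - x) dμ(x)`; it is used for `Im z > 0`, where the
integrand is bounded. -/
def cauchyTransform (μ : Measure ℝ) (z : ℂ) : ℂ :=
  ∫ x : ℝ, (z - (x : ℂ))⁻¹ ∂μ

/-- The self-energy (`K`-transform) `K_μ(z) = z - 1/G_μ(z)`; for a probability measure, `G_μ` has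
no zero in the upper half-plane. -/
def selfEnergy (μ : Measure ℝ) (z : ℂ) : ℂ :=
  z - (cauchyTransform μ z)⁻¹

/-- `ρ` is a Boolean convolution of `μ` and `ν`: it is a probability measure and
`K_ρ = K_μ + K_ν` on the upper half-plane. -/
def IsBooleanConv (μ ν ρ : Measure ℝ) : Prop :=
  IsProbabilityMeasure ρ ∧
    ∀ z : ℂ, 0 < z.im → selfEnergy ρ z = selfEnergy μ z + selfEnergy ν z

open Classical in
/-- The Boolean convolution `μ ⊎ ν`: the probability measure whose self-energy on the upper
half-plane is `K_μ + K_ν`. The zero measure, which is not a probability measure, is the value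
where there is no such measure (this does not happen for probability measures `μ`, `ν`). -/
def booleanConv (μ ν : Measure ℝ) : Measure ℝ :=
  if h : ∃ ρ : Measure ℝ, IsBooleanConv μ ν ρ then h.choose else 0

/-- The Boolean convolution powers `μ^{⊎ n}`, starting from the neutral element `δ₀`. -/
def booleanPow (μ : Measure ℝ) : ℕ → Measure ℝ
  | 0 => Measure.dirac 0
  | n + 1 => booleanConv (booleanPow μ n) μ

/-- The law `μ_n` of the Boolean central limit theorem: the dilation of `μ^{⊎ n}` by `1/√n`. -/
def booleanCLT (μ : Measure ℝ) (n : ℕ) : Measure ℝ :=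
  (booleanPow μ n).map (fun x : ℝ => 1 / √(n : ℝ) * x)

/-- The Boolean entropy `Γ(μ) = ∫ log |x| dμ(x)`, with `log 0 = -∞`, as the integral of the
positive part minus the integral of the negative part. It is meaningful when the positive part
has a finite integral, in particular when the second moment is finite. -/
def booleanEntropy (μ : Measure ℝ) : EReal :=
  ((∫⁻ x : ℝ, (ENNReal.log ‖x‖ₑ).toENNReal ∂μ : ℝ≥0∞) : EReal)
    - ((∫⁻ x : ℝ, (-ENNReal.log ‖x‖ₑ).toENNReal ∂μ : ℝ≥0∞) : EReal)

/-- The Boolean entropy relative to the Rademacher law `b = (δ₋₁ + δ₁)/2`, that is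
`Γ(μ|b) = (1/2) ∫ x² dμ(x) - ∫ log |x| dμ(x) - 1/2`, for `μ` with finite second moment. -/
def relBooleanEntropy (μ : Measure ℝ) : EReal :=
  ((1 / 2 : ℝ) : EReal) * ((∫⁻ x : ℝ, ‖x‖ₑ ^ 2 ∂μ : ℝ≥0∞) : EReal)
    - booleanEntropy μ - ((1 / 2 : ℝ) : EReal)

end

end BooleanProb

/-! Analytic core: write `y = x²`. Under `μ_n` the mean of `y` is `1`, so the relative entropy is
`-(1/2) ∫ log y`. For `n ≥ 2` the pointwise bound `-log y ≤ (1 - y) + 4 log n (1 - y)² + y⁻¹/n`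
(`neg_log_le`) integrates to `0 + 4 log n (m₄(μ_n) - 1) + m₋₂(μ_n)/n`. It remains to know that
`m₄(μ_n) - 1 = (m₄(μ) - 1)/n` and that `m₋₂(μ_n) = m₋₂(μ)`. Finiteness follows from the second
moment and `m₋₂`, nonnegativity from `log y ≤ y - 1`.

Moments: let `J(t) = ∫ (x² + t)⁻¹`. The self-energy equation at `z = i√t` reads `J_ν = J_μ / (n - (n
- 1) t J_μ)` for `ν = μ^{⊎ n}`. Letting `t → ∞` gives the second and fourth moments of `ν`, and `t →
0` gives its inverse second moment, all by monotone convergence.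

Existence: the Boolean powers are defined by choice, so a measure with self-energy `n K_μ` must be
produced. For symmetric `μ`, `G_μ(z) = -z S(-z²)` with `S(t) = ∫ (x² + t)⁻¹ dμ`, and with `c = 1 -
1/n` the function `(1 - c) S / (1 - t c S)` must be a Stieltjes transform. It is the matrix
coefficient at the vector `1` of the resolvent of `x²` on `L²(μ)` after rescaling that operator by a
rank-one perturbation of the identity. Working with `(1 + x²)⁻¹` keeps every operator bounded, and
the spectral theorem yields the measure. -/

namespace BooleanProb

/-! ### Spectral measures of bounded self-adjoint operators -/

section SpectralMeasure

variable {H : Type*} [NormedAddCommGroup H] [InnerProductSpace ℂ H] [CompleteSpace H]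

/-- The spectral measure of a bounded self-adjoint operator at a vector. -/
theorem exists_spectralMeasure (A : H →L[ℂ] H) (hA : IsSelfAdjoint A) (e : H) :
    ∃ τ : Measure ℝ, IsFiniteMeasure τ ∧ (∀ᵐ u ∂τ, u ∈ spectrum ℝ A) ∧ τ.real Set.univ = ‖e‖ ^ 2 ∧
      ∀ f : ℝ → ℝ, ContinuousOn f (spectrum ℝ A) →
        ∫ u, f u ∂τ = (inner ℂ e (cfc f A e)).re := by
  let X := spectrum ℝ A
  have : CompactSpace X := isCompact_iff_compactSpace.mp (spectrum.isCompact A)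
  let Λ₀ : CompactlySupportedContinuousMap X ℝ →ₗ[ℝ] ℝ :=
    { toFun := fun f => (inner ℂ e (cfcHom hA f.toContinuousMap e)).re
      map_add' := fun f g => by
        have : (f + g).toContinuousMap = f.toContinuousMap + g.toContinuousMap := rfl
        rw [this, map_add]
        simp
      map_smul' := fun c f => by
        have : (c • f).toContinuousMap = c • f.toContinuousMap := rfl
        rw [this, map_smul, smul_apply, inner_smul_right_eq_smul]
        simp }
  let Λ : CompactlySupportedContinuousMap X ℝ →ₚ[ℝ] ℝ := PositiveLinearMap.mk₀ Λ₀ (by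
    intro f hf
    have h1 : 0 ≤ cfcHom hA f.toContinuousMap := by
      rw [cfcHom_nonneg_iff]
      intro x
      exact hf x
    rw [ContinuousLinearMap.nonneg_iff_isPositive] at h1
    have := h1.re_inner_nonneg_right e
    change 0 ≤ (inner ℂ e (cfcHom hA f.toContinuousMap e)).re
    simpa using this)
  let ρ := RealRMK.rieszMeasure Λ
  have hfin : IsFiniteMeasure ρ := by
    constructor
    exact isCompact_univ.measure_lt_top
  have hX : MeasurableSet (spectrum ℝ A) := (spectrum.isClosed A).measurableSet
  have hint : ∀ f : ℝ → ℝ, ContinuousOn f (spectrum ℝ A) →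
      ∫ u, f u ∂(ρ.map Subtype.val) = (inner ℂ e (cfc f A e)).re := by
    intro f hf
    rw [(MeasurableEmbedding.subtype_coe hX).integral_map, cfc_apply f A hA hf]
    exact RealRMK.integral_rieszMeasure Λ
      (CompactlySupportedContinuousMap.continuousMapEquiv
        ⟨(spectrum ℝ A).domRestrict f, hf.domRestrict⟩)
  refine ⟨ρ.map Subtype.val, inferInstance, ?_, ?_, hint⟩
  · refine (ae_map_iff (p := fun u => u ∈ spectrum ℝ A) measurable_subtype_coe.aemeasurable
      (spectrum.isClosed A).measurableSet).mpr ?_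
    exact Eventually.of_forall fun x => x.2
  · have h := hint (fun _ => 1) continuousOn_const
    rw [cfc_const_one ℝ A] at h
    have h2 : (inner ℂ e ((1 : H →L[ℂ] H) e)).re = ‖e‖ ^ 2 := inner_self_eq_norm_sq (𝕜 := ℂ) e
    rw [h2] at h
    simpa using h

/-- The hypothesis says `A - A² ≥ 0`, so `u - u² ≥ 0` on the spectrum by the functional calculus. -/
theorem spectrum_subset_Icc_of_sub_sq_nonneg (A : H →L[ℂ] H) (hA : IsSelfAdjoint A)
    (hpos : ∀ f : H, 0 ≤ (inner ℂ (A f) (f - A f)).re) :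
    spectrum ℝ A ⊆ Set.Icc 0 1 := by
  have hsym := ContinuousLinearMap.isSelfAdjoint_iff_isSymmetric.mp hA
  have h1 : cfc (fun u : ℝ => u - u ^ 2) A = A - A ^ 2 := by
    rw [cfc_sub _ _ A, cfc_pow_id A 2, cfc_id' ℝ A]
  have h2 : 0 ≤ cfc (fun u : ℝ => u - u ^ 2) A := by
    rw [h1, ContinuousLinearMap.nonneg_iff_isPositive]
    have hs : IsSelfAdjoint (A - A ^ 2) := hA.sub (hA.pow 2)
    refine ⟨ContinuousLinearMap.isSelfAdjoint_iff_isSymmetric.mp hs, fun f => ?_⟩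
    have h3 := hpos f
    have h4 : inner ℂ (A (A f)) f = inner ℂ (A f) (A f) := hsym (A f) f
    rw [inner_sub_right] at h3
    simp only [ContinuousLinearMap.reApplyInnerSelf_apply, sub_apply, pow_two,
      mul_apply_eq_comp, inner_sub_left, h4]
    exact h3
  rw [cfc_nonneg_iff (fun u : ℝ => u - u ^ 2) A] at h2
  intro u hu
  have := h2 u hu
  constructor <;> nlinarith

theorem one_add_mul_ne_zero {t : ℂ} (ht : t ∈ Complex.slitPlane) {u : ℝ} (hu : u ∈ Set.Icc 0 1) :
    1 + (t - 1) * u ≠ 0 := by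
  intro h
  have hre := congrArg Complex.re h
  have him := congrArg Complex.im h
  simp at hre him
  rcases hu with ⟨h0, h1⟩
  rcases Complex.mem_slitPlane_iff.mp ht with h | h
  · have := mul_nonneg h.le h0
    obtain rfl : u = 1 := by linarith
    linarith
  · rcases him with him | him
    · exact h him
    · subst him; simp at hre

/-- With `u = 1/(1 + y)` the integrand is `1/(y + t)`: this converts spectral integrals on `[0, 1]`
into Stieltjes transforms on the half-line. The calculus is over `ℝ`, so the complex function `q` is
handled through its real and imaginary parts `G1` and `G2`. -/
theorem integral_resolvent_eq_inner {A : H →L[ℂ] H} (hA : IsSelfAdjoint A)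
    (hspec : spectrum ℝ A ⊆ Set.Icc 0 1) {e : H} {τ : Measure ℝ} [IsFiniteMeasure τ]
    (hτ : ∀ᵐ u ∂τ, u ∈ spectrum ℝ A)
    (hint : ∀ f : ℝ → ℝ, ContinuousOn f (spectrum ℝ A) →
        ∫ u, f u ∂τ = (inner ℂ e (cfc f A e)).re)
    {t : ℂ} (ht : t ∈ Complex.slitPlane) {v : H} (hv : v + (t - 1) • A v = A e) :
    ∫ u : ℝ, (u : ℂ) / (1 + (t - 1) * u) ∂τ = inner ℂ e v := by
  set q : ℝ → ℂ := fun u => (u : ℂ) / (1 + (t - 1) * u) with hq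
  have hqc : ContinuousOn q (spectrum ℝ A) := by
    apply ContinuousOn.div (by fun_prop) (by fun_prop)
    exact fun u hu => one_add_mul_ne_zero ht (hspec hu)
  have h1c : ContinuousOn (fun u => (q u).re) (spectrum ℝ A) :=
    Complex.continuous_re.comp_continuousOn hqc
  have h2c : ContinuousOn (fun u => (q u).im) (spectrum ℝ A) :=
    Complex.continuous_im.comp_continuousOn hqc
  set G1 := cfc (fun u => (q u).re) A with hG1
  set G2 := cfc (fun u => (q u).im) A with hG2
  have hquc : ∀ u ∈ spectrum ℝ A, q u + (t - 1) * u * q u = u := by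
    intro u hu
    have := one_add_mul_ne_zero ht (hspec hu)
    simp only [hq]
    rw [mul_div_assoc', ← add_div, div_eq_iff this]
    ring
  have e1 : G1 + (t - 1).re • (G1 * A) - (t - 1).im • (G2 * A) = A := by
    have : cfc (fun u => (q u).re + (t - 1).re • ((q u).re * u) - (t - 1).im • ((q u).im * u)) A
        = A := by
      nth_rewrite 2 [← cfc_id' ℝ A]
      apply cfc_congr
      intro u hu
      have := congrArg Complex.re (hquc u hu)
      simp at this ⊢
      linarith
    rw [cfc_sub (fun u => (q u).re + (t - 1).re • ((q u).re * u))
      (fun u => (t - 1).im • ((q u).im * u)) A, cfc_add (a := A) (fun u => (q u).re)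
      (fun u => (t - 1).re • ((q u).re * u)),
      cfc_smul _ (fun u => (q u).re * u) A, cfc_smul _ (fun u => (q u).im * u) A,
      cfc_mul (fun u => (q u).re) (fun u => u) A, cfc_mul (fun u => (q u).im) (fun u => u) A,
      cfc_id' ℝ A] at this
    exact this
  have e2 : G2 + (t - 1).re • (G2 * A) + (t - 1).im • (G1 * A) = 0 := by
    have : cfc (fun u => (q u).im + (t - 1).re • ((q u).im * u) + (t - 1).im • ((q u).re * u)) A
        = 0 := by
      rw [← cfc_const_zero ℝ A]
      apply cfc_congr
      intro u hu
      have := congrArg Complex.im (hquc u hu)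
      simp at this ⊢
      linarith
    rw [cfc_add (a := A) (fun u => (q u).im + (t - 1).re • ((q u).im * u))
      (fun u => (t - 1).im • ((q u).re * u)), cfc_add (a := A) (fun u => (q u).im)
      (fun u => (t - 1).re • ((q u).im * u)),
      cfc_smul _ (fun u => (q u).im * u) A, cfc_smul _ (fun u => (q u).re * u) A,
      cfc_mul (fun u => (q u).re) (fun u => u) A, cfc_mul (fun u => (q u).im) (fun u => u) A,
      cfc_id' ℝ A] at this
    exact this
  have hsc : ∀ (a : ℝ) (x : H), a • x = (a : ℂ) • x := fun a x => (Complex.coe_smul a x).symm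
  -- Since `e = y + (t - 1) A y` with `A y = v`, applying `q(A) (1 + (t - 1) A) = A` to `y` gives
  -- `q(A) e = A y = v`; no inverse is needed.
  have key : G1 e + Complex.I • G2 e = v := by
    set y := e - (t - 1) • v with hy
    have hyv : A y = v := by
      rw [hy, map_sub, map_smul, ← hv]; abel
    have f1 := congrArg (fun T : H →L[ℂ] H => T y) e1
    have f2 := congrArg (fun T : H →L[ℂ] H => T y) e2
    simp only [add_apply, sub_apply,
      smul_apply, mul_apply_eq_comp, hyv,
      zero_apply, hsc] at f1 f2
    have hee : e = y + (t - 1) • v := by rw [hy]; abel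
    have ht1 : (t - 1) = ((t - 1).re : ℂ) + Complex.I * ((t - 1).im : ℂ) := by
      rw [mul_comm]; exact (Complex.re_add_im _).symm
    have f3 : G1 e + Complex.I • G2 e
        = (G1 y + ((t - 1).re : ℂ) • G1 v - ((t - 1).im : ℂ) • G2 v)
          + Complex.I • (G2 y + ((t - 1).re : ℂ) • G2 v + ((t - 1).im : ℂ) • G1 v) := by
      rw [hee, map_add, map_add, map_smul, map_smul]
      generalize hr : ((t - 1).re : ℂ) = r at ht1 ⊢
      generalize hi : ((t - 1).im : ℂ) = i at ht1 ⊢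
      rw [ht1]
      have hI : Complex.I * Complex.I = -1 := Complex.I_mul_I
      match_scalars <;> first | ring1 | linear_combination i * hI
    rw [f3, f1, f2, smul_zero, add_zero]
  have hreal : ∀ f : ℝ → ℝ, (inner ℂ e (cfc f A e)).im = 0 := by
    intro f
    have : IsSelfAdjoint (cfc f A) := cfc_predicate f A
    have h := (ContinuousLinearMap.isSelfAdjoint_iff_isSymmetric.mp this) e e
    have h' : inner ℂ e (cfc f A e) = starRingEnd ℂ (inner ℂ e (cfc f A e)) := by
      rw [inner_conj_symm]; exact h.symm
    exact Complex.conj_eq_iff_im.mp h'.symm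
  have hqb : Integrable q τ := by
    obtain ⟨C, hC⟩ := (spectrum.isCompact A).exists_bound_of_continuousOn hqc
    apply Integrable.of_bound (C := C) ?_ (hτ.mono fun u hu => hC u hu)
    exact Measurable.aestronglyMeasurable (by fun_prop)
  have i1 := hint _ h1c
  have i2 := hint _ h2c
  rw [← key, inner_add_right, inner_smul_right]
  apply Complex.ext
  · have : (∫ u, q u ∂τ).re = ∫ u, (q u).re ∂τ := (integral_re hqb).symm
    simp [this, i1, hreal, hG1, hG2]
  · have : (∫ u, q u ∂τ).im = ∫ u, (q u).im ∂τ := (integral_im hqb).symm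
    simp [this, i2, hreal, hG1, hG2]

end SpectralMeasure

/-! ### Rank-one rescaling of a positive operator -/

section RankOne

variable {H : Type*} [NormedAddCommGroup H] [InnerProductSpace ℂ H] [CompleteSpace H]

omit [CompleteSpace H] in
theorem re_inner_apply_self_le_one {B : H →L[ℂ] H}
    (hpos : ∀ k : H, 0 ≤ (inner ℂ (B k) (k - B k)).re) {e : H} (he : ‖e‖ = 1) :
    (inner ℂ (B e) e).re ≤ 1 := by
  have h := hpos e
  rw [inner_sub_right, Complex.sub_re] at h
  have h1 : (inner ℂ (B e) (B e)).re = ‖B e‖ ^ 2 := by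
    have := inner_self_eq_norm_sq (𝕜 := ℂ) (B e)
    simpa using this
  have h2 : (inner ℂ (B e) e).re ≤ ‖B e‖ := by
    have := re_inner_le_norm (𝕜 := ℂ) (B e) e
    rw [he, mul_one] at this
    simpa using this
  rw [h1] at h
  nlinarith [norm_nonneg (B e)]

/-- If `B = (1 + s)⁻¹` for a positive operator `s`, then the resolvent of `D s D` with
`D = 1 + ((1 - c)⁻¹ᐟ² - 1) P`, where `P` is the projection onto the unit vector `e`, is again given
by an operator between `0` and `1`, and its matrix coefficients at `e` are those of `s` up to a
fractional linear transformation. -/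
theorem exists_operator_of_rankOne_scaling {B : H →L[ℂ] H} (hB : IsSelfAdjoint B)
    (hpos : ∀ k : H, 0 ≤ (inner ℂ (B k) (k - B k)).re) {e : H} (he : ‖e‖ = 1)
    {c : ℝ} (hc0 : 0 ≤ c) (hc1 : c < 1) :
    ∃ A : H →L[ℂ] H, IsSelfAdjoint A ∧ (∀ f : H, 0 ≤ (inner ℂ (A f) (f - A f)).re) ∧
      ∀ (t S : ℂ) (r : H), r + (t - 1) • B r = B e → inner ℂ e r = S → 1 - t * c * S ≠ 0 →
        ∃ v : H, v + (t - 1) • A v = A e ∧ inner ℂ e v = (1 - c) * S / (1 - t * c * S) := by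
  have hBs := ContinuousLinearMap.isSelfAdjoint_iff_isSymmetric.mp hB
  have hBs' : ∀ x y : H, inner ℂ (B x) y = inner ℂ x (B y) := fun x y => hBs x y
  have hee : inner ℂ e e = (1 : ℂ) := by
    rw [inner_self_eq_norm_sq_to_K, he]; simp
  set b := B e with hb
  obtain ⟨β, hβ⟩ : ∃ β : ℝ, inner ℂ e b = (β : ℂ) := by
    refine ⟨(inner ℂ e b).re, ?_⟩
    symm
    rw [← Complex.conj_eq_iff_re, inner_conj_symm, hb, hBs']
  have hβ1 : β ≤ 1 := by
    have := re_inner_apply_self_le_one hpos he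
    rw [hBs', ← hb, hβ] at this
    simpa using this
  have hcβ : 1 - c * β ≠ 0 := by
    have : c * β < 1 := by
      rcases le_or_gt β 0 with h | h <;> nlinarith
    linarith
  -- The operator `D = 1 - δ P` below is the inverse of the scaling `1 + ((1 - c)⁻¹ᐟ² - 1) P`, so
  -- `D² = 1 - c P`. Formally the sought operator is `D (s + D²)⁻¹ D = D (B⁻¹ - c P)⁻¹ D`.
  set δ : ℝ := 1 - √(1 - c) with hδ
  have hδ2 : (1 - (δ : ℂ)) ^ 2 = 1 - c := by
    have : (1 - δ) ^ 2 = 1 - c := by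
      rw [hδ, sub_sub_cancel, Real.sq_sqrt (by linarith)]
    exact_mod_cast this
  -- Sherman–Morrison: `(B⁻¹ - c P)⁻¹ = B + γ ⟨b, ·⟩ b`, which is `M`.
  set γ : ℝ := c / (1 - c * β) with hγ
  have hγβ : (γ : ℂ) = c * (1 + γ * β) := by
    have : γ = c * (1 + γ * β) := by
      rw [hγ]; field_simp; ring
    exact_mod_cast this
  let D : H →L[ℂ] H :=
    ContinuousLinearMap.id ℂ H - (δ : ℂ) • (innerSL ℂ e).smulRight e
  let M : H →L[ℂ] H := B + (γ : ℂ) • (innerSL ℂ b).smulRight b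
  have hD : ∀ f, D f = f - ((δ : ℂ) * inner ℂ e f) • e := by
    intro f; simp [D, mul_smul]
  have hM : ∀ f, M f = B f + ((γ : ℂ) * inner ℂ b f) • b := by
    intro f; simp [M, mul_smul]
  have hDs : ∀ x y, inner ℂ (D x) y = inner ℂ x (D y) := by
    intro x y
    simp only [hD, inner_sub_left, inner_sub_right, inner_smul_left, inner_smul_right, map_mul,
      Complex.conj_ofReal, inner_conj_symm]
    ring
  have hMs : ∀ x y, inner ℂ (M x) y = inner ℂ x (M y) := by
    intro x y
    simp only [hM, inner_add_left, inner_add_right, inner_smul_left, inner_smul_right, map_mul,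
      Complex.conj_ofReal, inner_conj_symm, hBs']
    ring
  have hbf : ∀ f, inner ℂ b f = inner ℂ e (B f) := fun f => hBs' e f
  have hDD : ∀ g, D (D g) = g - ((c : ℂ) * inner ℂ e g) • e := by
    intro g
    rw [hD, hD]
    simp only [inner_sub_right, inner_smul_right, hee]
    match_scalars
    · rfl
    · linear_combination (inner ℂ e g) * hδ2
  have hDe : D e = (1 - δ : ℂ) • e := by
    rw [hD, hee]; module
  have hMe : M e = (1 + γ * β : ℂ) • b := by
    rw [hM, hbf, ← hb, hβ]; module
  refine ⟨D ∘L M ∘L D, ?_, ?_, ?_⟩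
  · rw [ContinuousLinearMap.isSelfAdjoint_iff_isSymmetric]
    intro x y
    change inner ℂ (D (M (D x))) y = inner ℂ x (D (M (D y)))
    rw [hDs, hMs, hDs]
  · intro f
    change 0 ≤ (inner ℂ (D (M (D f))) (f - D (M (D f)))).re
    set g := M (D f) with hg
    rw [hDs, map_sub, hDD]
    -- Put `k = D f + c ⟨e, g⟩ e`. Then `g = B k` and `D f - D² g = k - B k`, so positivity is
    -- inherited from `B` at `k`.
    have hBk : B (D f + ((c : ℂ) * inner ℂ e g) • e) = g := by
      have : (c : ℂ) * inner ℂ e g = γ * inner ℂ b (D f) := by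
        rw [hg, hM, inner_add_right, inner_smul_right, hβ, ← hbf]
        nth_rewrite 2 [hγβ]
        ring
      rw [map_add, map_smul, this, ← hb, hg, hM]
    have := hpos (D f + ((c : ℂ) * inner ℂ e g) • e)
    rw [hBk] at this
    convert this using 3
    abel
  · intro t S r hr hS hne
    -- Formally `r = (s + t)⁻¹ e`; a second rank-one inversion, now of `s + t (1 - c P)`, produces
    -- the factor `1 / (1 - t c S)`.
    refine ⟨(1 / (1 - t * c * S) * (1 - δ)) • D r, ?_, ?_⟩
    · change _ + (t - 1) • D (M (D _)) = D (M (D e))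
      rw [hDe, map_smul, map_smul, map_smul, map_smul, map_smul, hDD, hS]
      suffices h : (1 / (1 - t * c * S)) • (r + (t - 1) • M (r - (c * S) • e)) = M e by
        rw [← h]
        simp only [map_smul, map_add, smul_add, map_sub]
        module
      have hr' : (t - 1) • B r = b - r := by rw [← hr]; abel
      have hbr : (t - 1) * inner ℂ b r = β - S := by
        rw [hbf, ← inner_smul_right, hr', inner_sub_right, hβ, hS]
      have h1 : (t - 1) • M r = (b - r) + ((γ : ℂ) * (β - S)) • b := by
        rw [hM, smul_add, hr', smul_smul, ← hbr]
        congr 2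
        ring
      rw [map_sub, map_smul, smul_sub, h1, hMe]
      match_scalars
      · ring
      · field_simp
        linear_combination (-S) * hγβ
    · rw [hD, inner_smul_right, inner_sub_right, inner_smul_right, hee, hS]
      rw [← hδ2]
      ring

end RankOne

/-! ### The operator `(1 + x²)⁻¹` on `L²(μ)` -/

section Stieltjes

theorem sq_add_ne_zero {t : ℂ} (ht : t ∈ Complex.slitPlane) (x : ℝ) : (x : ℂ) ^ 2 + t ≠ 0 := by
  intro h
  have hre := congrArg Complex.re h
  have him := congrArg Complex.im h
  simp [pow_two] at hre him
  rcases Complex.mem_slitPlane_iff.mp ht with h | h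
  · nlinarith
  · exact h him

theorem exists_norm_sq_add_inv_le {t : ℂ} (ht : t ∈ Complex.slitPlane) :
    ∃ C : ℝ, ∀ x : ℝ, ‖((x : ℂ) ^ 2 + t)⁻¹‖ ≤ C := by
  rcases Complex.mem_slitPlane_iff.mp ht with h | h
  · refine ⟨t.re⁻¹, fun x => ?_⟩
    rw [norm_inv]
    apply inv_anti₀ h
    refine le_trans ?_ (Complex.re_le_norm _)
    simp [pow_two]
    nlinarith
  · refine ⟨|t.im|⁻¹, fun x => ?_⟩
    rw [norm_inv]
    apply inv_anti₀ (by positivity)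
    refine le_trans ?_ (Complex.abs_im_le_norm _)
    simp [pow_two]

theorem memLp_sq_add_inv (μ : Measure ℝ) [IsFiniteMeasure μ] (p : ℝ≥0∞) {t : ℂ}
    (ht : t ∈ Complex.slitPlane) : MemLp (fun x : ℝ => ((x : ℂ) ^ 2 + t)⁻¹) p μ := by
  obtain ⟨C, hC⟩ := exists_norm_sq_add_inv_le ht
  exact MemLp.of_bound (Measurable.aestronglyMeasurable (by fun_prop)) C
    (Eventually.of_forall hC)

/-- Multiplication by `(1 + x²)⁻¹` on `L²(μ)`. -/
noncomputable def mulResolvent (μ : Measure ℝ) [IsFiniteMeasure μ] : Lp ℂ 2 μ →L[ℂ] Lp ℂ 2 μ :=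
  (ContinuousLinearMap.mul ℂ ℂ).holderL μ ∞ 2 2
    ((memLp_sq_add_inv μ ∞ Complex.one_mem_slitPlane).toLp _)

theorem coeFn_mulResolvent (μ : Measure ℝ) [IsFiniteMeasure μ] (f : Lp ℂ 2 μ) :
    ⇑(mulResolvent μ f) =ᵐ[μ] fun x => ((x : ℂ) ^ 2 + 1)⁻¹ * f x := by
  have h := (ContinuousLinearMap.mul ℂ ℂ).coeFn_holder (r := 2)
    ((memLp_sq_add_inv μ ∞ Complex.one_mem_slitPlane).toLp _) f
  filter_upwards [h, (memLp_sq_add_inv μ ∞ Complex.one_mem_slitPlane).coeFn_toLp] with x h1 h2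
  rw [← h2]
  exact h1

theorem isSelfAdjoint_mulResolvent (μ : Measure ℝ) [IsFiniteMeasure μ] :
    IsSelfAdjoint (mulResolvent μ) := by
  rw [ContinuousLinearMap.isSelfAdjoint_iff_isSymmetric]
  intro f g
  change inner ℂ (mulResolvent μ f) g = inner ℂ f (mulResolvent μ g)
  rw [L2.inner_def, L2.inner_def]
  apply integral_congr_ae
  filter_upwards [coeFn_mulResolvent μ f, coeFn_mulResolvent μ g] with x hf hg
  rw [hf, hg]
  simp only [RCLike.inner_apply, map_mul, map_inv₀, map_add, map_pow, map_one, Complex.conj_ofReal]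
  ring

theorem re_inner_mulResolvent_sub_nonneg (μ : Measure ℝ) [IsFiniteMeasure μ] (k : Lp ℂ 2 μ) :
    0 ≤ (inner ℂ (mulResolvent μ k) (k - mulResolvent μ k)).re := by
  have hre : (inner ℂ (mulResolvent μ k) (k - mulResolvent μ k)).re
      = ∫ x, (inner ℂ (mulResolvent μ k x) ((k - mulResolvent μ k : Lp ℂ 2 μ) x)).re ∂μ := by
    rw [L2.inner_def]
    exact (integral_re (L2.integrable_inner (𝕜 := ℂ) _ _)).symm
  rw [hre]
  apply integral_nonneg_of_ae
  filter_upwards [coeFn_mulResolvent μ k, Lp.coeFn_sub k (mulResolvent μ k)] with x hf hg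
  rw [hg, Pi.sub_apply, hf]
  have h1 : (((x : ℂ) ^ 2 + 1)⁻¹) = (((x ^ 2 + 1)⁻¹ : ℝ) : ℂ) := by push_cast; rfl
  have h2 : inner ℂ (((x : ℂ) ^ 2 + 1)⁻¹ * k x) (k x - ((x : ℂ) ^ 2 + 1)⁻¹ * k x)
      = (((x ^ 2 + 1)⁻¹ * (1 - (x ^ 2 + 1)⁻¹) * ‖k x‖ ^ 2 : ℝ) : ℂ) := by
    rw [h1, RCLike.inner_apply, map_mul, Complex.conj_ofReal]
    push_cast
    rw [← Complex.mul_conj']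
    ring
  rw [h2, Complex.ofReal_re]
  have h3 : (x ^ 2 + 1)⁻¹ ≤ 1 := inv_le_one_of_one_le₀ (by nlinarith [sq_nonneg x])
  have h4 : 0 ≤ (x ^ 2 + 1)⁻¹ := by positivity
  exact mul_nonneg (mul_nonneg h4 (by linarith)) (by positivity)

/-- Fractional linear transformations of the Stieltjes transform of the law of `x²`, as they occur
in Boolean convolution powers, are Stieltjes transforms. -/
theorem exists_measure_integral_resolvent (μ : Measure ℝ) [IsProbabilityMeasure μ]
    {c : ℝ} (hc0 : 0 ≤ c) (hc1 : c < 1) :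
    ∃ τ : Measure ℝ, IsFiniteMeasure τ ∧ (∀ᵐ u ∂τ, u ∈ Set.Icc (0 : ℝ) 1) ∧ τ.real Set.univ = 1 ∧
      ∀ t ∈ Complex.slitPlane, ∀ S : ℂ, ∫ x : ℝ, ((x : ℂ) ^ 2 + t)⁻¹ ∂μ = S →
        1 - t * c * S ≠ 0 →
        ∫ u : ℝ, (u : ℂ) / (1 + (t - 1) * u) ∂τ = (1 - c) * S / (1 - t * c * S) := by
  have h1 : MemLp (fun _ : ℝ => (1 : ℂ)) 2 μ := memLp_const 1
  set e : Lp ℂ 2 μ := h1.toLp _ with he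
  have hen : ‖e‖ = 1 := by
    rw [he, Lp.norm_toLp, eLpNorm_const' _ (by simp) (by simp)]
    simp
  obtain ⟨A, hA, hApos, hAres⟩ := exists_operator_of_rankOne_scaling (isSelfAdjoint_mulResolvent μ)
    (re_inner_mulResolvent_sub_nonneg μ) hen hc0 hc1
  have hspec := spectrum_subset_Icc_of_sub_sq_nonneg A hA hApos
  obtain ⟨τ, hfin, hτ, hmass, hint⟩ := exists_spectralMeasure A hA e
  refine ⟨τ, hfin, hτ.mono fun u hu => hspec hu, by rw [hmass, hen, one_pow], ?_⟩
  · intro t ht S hS hne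
    set r : Lp ℂ 2 μ := (memLp_sq_add_inv μ 2 ht).toLp _ with hr
    have hr1 : r + (t - 1) • mulResolvent μ r = mulResolvent μ e := by
      apply Lp.ext
      filter_upwards [Lp.coeFn_add r ((t - 1) • mulResolvent μ r),
        Lp.coeFn_smul (t - 1) (mulResolvent μ r), coeFn_mulResolvent μ r, coeFn_mulResolvent μ e,
        (memLp_sq_add_inv μ 2 ht).coeFn_toLp, h1.coeFn_toLp] with x e1 e2 e3 e4 e5 e6
      rw [e1, Pi.add_apply, e2, Pi.smul_apply, e3, e4, hr, e5, he, e6]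
      have n1 := sq_add_ne_zero ht x
      have n2 := sq_add_ne_zero Complex.one_mem_slitPlane x
      simp only [smul_eq_mul]
      field_simp
      ring
    have hr2 : inner ℂ e r = S := by
      rw [L2.inner_def, ← hS]
      apply integral_congr_ae
      filter_upwards [(memLp_sq_add_inv μ 2 ht).coeFn_toLp, h1.coeFn_toLp] with x e5 e6
      rw [he, hr, e5, e6]
      simp
    obtain ⟨v, hv, hv2⟩ := hAres t S r hr1 hr2 hne
    rw [integral_resolvent_eq_inner hA hspec hτ hint ht hv, hv2]

end Stieltjes

/-! ### Cauchy transforms in the upper half-plane -/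

section CauchyTransform

theorem sub_ofReal_ne_zero {z : ℂ} (hz : 0 < z.im) (x : ℝ) : z - (x : ℂ) ≠ 0 := by
  intro h
  have := congrArg Complex.im h
  simp at this
  exact hz.ne' this

theorem norm_sub_ofReal_inv_le {z : ℂ} (hz : 0 < z.im) (x : ℝ) :
    ‖(z - (x : ℂ))⁻¹‖ ≤ z.im⁻¹ := by
  rw [norm_inv]
  apply inv_anti₀ hz
  refine le_trans ?_ (Complex.im_le_norm _)
  simp

theorem integrable_sub_ofReal_inv (μ : Measure ℝ) [IsFiniteMeasure μ] {z : ℂ} (hz : 0 < z.im) :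
    Integrable (fun x : ℝ => (z - (x : ℂ))⁻¹) μ :=
  Integrable.of_bound (Measurable.aestronglyMeasurable (by fun_prop)) z.im⁻¹
    (Eventually.of_forall (norm_sub_ofReal_inv_le hz))

/-- Equivalent to `Im (1/G) ≥ Im z`. It is Jensen's inequality for `|z - x|⁻¹`, because `-Im G = Im
z ∫ |z - x|⁻² dμ`. -/
theorem mul_norm_cauchyTransform_sq_le (μ : Measure ℝ) [IsProbabilityMeasure μ] {z : ℂ}
    (hz : 0 < z.im) :
    z.im * ‖cauchyTransform μ z‖ ^ 2 ≤ -(cauchyTransform μ z).im := by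
  set f : ℝ → ℝ := fun x => ‖(z - (x : ℂ))⁻¹‖ with hf
  have hfm : Measurable f := by fun_prop
  have hfi : Integrable f μ := (integrable_sub_ofReal_inv μ hz).norm
  have hf2 : Integrable (fun x => f x ^ 2) μ := by
    refine Integrable.of_bound (hfm.pow_const 2).aestronglyMeasurable (z.im⁻¹ ^ 2)
      (Eventually.of_forall fun x => ?_)
    rw [Real.norm_of_nonneg (by positivity)]
    exact pow_le_pow_left₀ (norm_nonneg _) (norm_sub_ofReal_inv_le hz x) 2
  have him : -(cauchyTransform μ z).im = z.im * ∫ x, f x ^ 2 ∂μ := by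
    have h1 : (cauchyTransform μ z).im = ∫ x : ℝ, ((z - (x : ℂ))⁻¹).im ∂μ :=
      (integral_im (integrable_sub_ofReal_inv μ hz)).symm
    rw [h1, ← integral_neg, ← integral_const_mul]
    apply integral_congr_ae
    refine Eventually.of_forall fun x => ?_
    simp only [hf, Complex.inv_im, Complex.sub_im, Complex.ofReal_im, sub_zero, norm_inv, inv_pow,
      Complex.sq_norm]
    ring
  have hvar : (∫ x, f x ∂μ) ^ 2 ≤ ∫ x, f x ^ 2 ∂μ := by
    set a := ∫ x, f x ∂μ with ha
    have h0 : 0 ≤ ∫ x, (f x ^ 2 - 2 * a * f x + a ^ 2) ∂μ :=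
      integral_nonneg fun x => by simp only [Pi.zero_apply]; nlinarith [sq_nonneg (f x - a)]
    have hi : Integrable (fun x => f x ^ 2 - 2 * a * f x) μ := hf2.sub (hfi.const_mul _)
    rw [integral_add hi (integrable_const _),
      integral_sub hf2 (hfi.const_mul _), integral_const_mul, ← ha] at h0
    simp at h0
    nlinarith
  have hnorm : ‖cauchyTransform μ z‖ ≤ ∫ x, f x ∂μ := norm_integral_le_integral_norm _
  rw [him]
  exact mul_le_mul_of_nonneg_left
    ((pow_le_pow_left₀ (norm_nonneg _) hnorm 2).trans hvar) hz.le

theorem cauchyTransform_ne_zero (μ : Measure ℝ) [IsProbabilityMeasure μ] {z : ℂ}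
    (hz : 0 < z.im) : cauchyTransform μ z ≠ 0 := by
  have h1 : (cauchyTransform μ z).im = ∫ x : ℝ, ((z - (x : ℂ))⁻¹).im ∂μ :=
    (integral_im (integrable_sub_ofReal_inv μ hz)).symm
  have hneg : 0 < ∫ x : ℝ, -((z - (x : ℂ))⁻¹).im ∂μ := by
    rw [integral_pos_iff_support_of_nonneg]
    · have : Function.support (fun x : ℝ => -((z - (x : ℂ))⁻¹).im) = Set.univ := by
        ext x
        have := sub_ofReal_ne_zero hz x
        simp [Complex.inv_im, hz.ne', this]
      rw [this]
      simp
    · intro x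
      simp only [Pi.zero_apply, Complex.inv_im, Complex.sub_im, Complex.ofReal_im, sub_zero]
      have := Complex.normSq_nonneg (z - x)
      rw [neg_div, neg_neg]
      positivity
    · exact (integrable_sub_ofReal_inv μ hz).im.neg
  intro h
  rw [integral_neg, ← h1, h] at hneg
  simp at hneg

/-- If `c z G = 1`, then `Im (1/G) = c Im z < Im z`, against the previous bound. -/
theorem one_sub_mul_cauchyTransform_ne_zero (μ : Measure ℝ) [IsProbabilityMeasure μ] {z : ℂ}
    (hz : 0 < z.im) {c : ℝ} (hc : c < 1) : 1 - c * (z * cauchyTransform μ z) ≠ 0 := by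
  intro h
  have h1 := mul_norm_cauchyTransform_sq_le μ hz
  have h0 := Complex.normSq_pos.mpr (cauchyTransform_ne_zero μ hz)
  rw [Complex.sq_norm] at h1
  have hre := congrArg Complex.re h
  have him := congrArg Complex.im h
  set G := cauchyTransform μ z
  simp at hre him
  have h3 : c * z.im * Complex.normSq G = -G.im := by
    rw [Complex.normSq_apply]
    rcases him with h | h
    · subst h; simp at hre
    · linear_combination (c * G.re) * h + G.im * hre
  nlinarith [mul_pos hz h0]

theorem neg_sq_mem_slitPlane {z : ℂ} (hz : 0 < z.im) : -z ^ 2 ∈ Complex.slitPlane := by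
  rw [Complex.mem_slitPlane_iff]
  by_cases h : z.re = 0
  · left
    simp [pow_two, h]
    positivity
  · right
    simp [pow_two]
    intro h'
    have : z.re * z.im = 0 := by linarith
    simp [h, hz.ne'] at this

theorem inv_sub_add_inv_add {z : ℂ} (hz : 0 < z.im) (x : ℝ) :
    (z - (x : ℂ))⁻¹ + (z - ((-x : ℝ) : ℂ))⁻¹ = 2 * (-z * ((x : ℂ) ^ 2 + -z ^ 2)⁻¹) := by
  have h1 := sub_ofReal_ne_zero hz x
  have h2 := sub_ofReal_ne_zero hz (-x)
  have h3 := sq_add_ne_zero (neg_sq_mem_slitPlane hz) x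
  field_simp
  push_cast
  ring

/-- Average the integrand over `x` and `-x`. -/
theorem cauchyTransform_of_symm {μ : Measure ℝ} [IsProbabilityMeasure μ]
    (hsymm : μ.map (fun x : ℝ => -x) = μ) {z : ℂ} (hz : 0 < z.im) :
    cauchyTransform μ z = -z * ∫ x : ℝ, ((x : ℂ) ^ 2 + -z ^ 2)⁻¹ ∂μ := by
  have hi := integrable_sub_ofReal_inv μ hz
  have h1 : cauchyTransform μ z = ∫ x : ℝ, (z - ((-x : ℝ) : ℂ))⁻¹ ∂μ := by
    unfold cauchyTransform
    conv_lhs => rw [← hsymm]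
    rw [integral_map (by fun_prop) (Measurable.aestronglyMeasurable (by fun_prop))]
  have hi' : Integrable (fun x : ℝ => (z - ((-x : ℝ) : ℂ))⁻¹) μ := by
    refine Integrable.of_bound (Measurable.aestronglyMeasurable (by fun_prop)) z.im⁻¹
      (Eventually.of_forall fun x => norm_sub_ofReal_inv_le hz (-x))
  have h2 : 2 * cauchyTransform μ z = 2 * (-z * ∫ x : ℝ, ((x : ℂ) ^ 2 + -z ^ 2)⁻¹ ∂μ) := by
    rw [two_mul]
    nth_rewrite 2 [h1]
    unfold cauchyTransform
    rw [← integral_add hi hi', ← integral_const_mul, ← integral_const_mul]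
    simp_rw [inv_sub_add_inv_add hz]
  exact mul_left_cancel₀ two_ne_zero h2

end CauchyTransform

/-! ### Existence of Boolean powers -/

section BooleanPower

theorem tendsto_div_sq_add (x : ℝ) :
    Tendsto (fun k : ℕ => ((k : ℝ) + 1) / (x ^ 2 + ((k : ℝ) + 1))) atTop (nhds 1) := by
  have h1 : Tendsto (fun k : ℕ => 1 - x ^ 2 / (x ^ 2 + (k + 1) : ℝ)) atTop (nhds (1 - 0)) := by
    apply Tendsto.const_sub
    apply Tendsto.const_div_atTop
    exact tendsto_atTop_add_const_left _ _
      (tendsto_atTop_add_const_right _ _ tendsto_natCast_atTop_atTop)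
  rw [sub_zero] at h1
  refine h1.congr fun k => ?_
  have : (x ^ 2 + (k + 1) : ℝ) ≠ 0 := by positivity
  field_simp
  ring

theorem tendsto_mul_integral_sq_add_inv (μ : Measure ℝ) [IsProbabilityMeasure μ] :
    Tendsto (fun k : ℕ => ((k : ℂ) + 1) * ∫ x : ℝ, ((x : ℂ) ^ 2 + ((k : ℂ) + 1))⁻¹ ∂μ) atTop
      (nhds 1) := by
  have h : Tendsto (fun k : ℕ => ∫ x : ℝ, (((k + 1) / (x ^ 2 + (k + 1)) : ℝ) : ℂ) ∂μ) atTop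
      (nhds (∫ _ : ℝ, 1 ∂μ)) := by
    apply tendsto_integral_of_dominated_convergence (fun _ => (1 : ℝ))
    · exact fun k => Measurable.aestronglyMeasurable (by fun_prop)
    · exact integrable_const _
    · refine fun k => Eventually.of_forall fun x => ?_
      rw [Complex.norm_real, Real.norm_of_nonneg (by positivity)]
      apply div_le_one_of_le₀ <;> nlinarith [sq_nonneg x]
    · refine Eventually.of_forall fun x => ?_
      exact_mod_cast (Complex.continuous_ofReal.tendsto 1).comp (tendsto_div_sq_add x)
  simp only [integral_const, probReal_univ, one_smul] at h
  refine h.congr fun k => ?_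
  rw [← integral_const_mul]
  apply integral_congr_ae
  refine Eventually.of_forall fun x => ?_
  push_cast
  rw [div_eq_mul_inv]

/-- The point `u = 0` corresponds to `y = ∞`. As `(k + 1) u / (1 + k u)` tends to the indicator of
`u ≠ 0`, the limit computes `τ {u ≠ 0}`, which thus equals the total mass. -/
theorem ae_ne_zero_of_tendsto {τ : Measure ℝ} [IsFiniteMeasure τ]
    (hτ : ∀ᵐ u ∂τ, u ∈ Set.Icc (0 : ℝ) 1) (hmass : τ.real Set.univ = 1)
    (hlim : Tendsto (fun k : ℕ => ((k : ℂ) + 1) *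
      ∫ u : ℝ, (u : ℂ) / (1 + (((k : ℂ) + 1) - 1) * u) ∂τ) atTop (nhds 1)) :
    ∀ᵐ u ∂τ, u ≠ 0 := by
  have h : Tendsto (fun k : ℕ => ∫ u : ℝ, (((k + 1) * u / (1 + k * u) : ℝ) : ℂ) ∂τ) atTop
      (nhds (∫ u : ℝ, Set.indicator {0}ᶜ (fun _ => (1 : ℂ)) u ∂τ)) := by
    apply tendsto_integral_of_dominated_convergence (fun _ => (1 : ℝ))
    · exact fun k => Measurable.aestronglyMeasurable (by fun_prop)
    · exact integrable_const _
    · refine fun k => hτ.mono fun u hu => ?_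
      obtain ⟨h0, h1⟩ := hu
      rw [Complex.norm_real, Real.norm_of_nonneg (by positivity)]
      apply div_le_one_of_le₀
      · nlinarith
      · positivity
    · filter_upwards [hτ] with u hu
      rcases hu.1.eq_or_lt with rfl | h0
      · simp
      · have h2 : Tendsto (fun k : ℕ => 1 + (u - 1) / (1 + k * u : ℝ)) atTop (nhds (1 + 0)) := by
          apply Tendsto.const_add
          apply Tendsto.const_div_atTop
          exact tendsto_atTop_add_const_left _ _
            (tendsto_natCast_atTop_atTop.atTop_mul_const h0)
        have h3 : (fun k : ℕ => 1 + (u - 1) / (1 + k * u : ℝ))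
            = fun k : ℕ => ((k + 1) * u / (1 + k * u) : ℝ) := by
          ext k
          have : (1 + k * u : ℝ) ≠ 0 := by positivity
          field_simp
          ring
        rw [h3, add_zero] at h2
        rw [Set.indicator_of_mem (by simpa using h0.ne')]
        exact_mod_cast (Complex.continuous_ofReal.tendsto 1).comp h2
  have heq := tendsto_nhds_unique h (hlim.congr fun k => by
    rw [← integral_const_mul]
    apply integral_congr_ae
    refine Eventually.of_forall fun u => ?_
    push_cast
    rw [mul_div_assoc, add_sub_cancel_right])
  rw [integral_indicator_const _ (measurableSet_singleton 0).compl] at heq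
  simp only [Complex.real_smul, mul_one, Complex.ofReal_eq_one] at heq
  have h4 := measureReal_compl (μ := τ) (measurableSet_singleton (0 : ℝ))
  rw [heq, hmass] at h4
  have h5 : τ.real {0} = 0 := by linarith
  rw [measureReal_eq_zero_iff] at h5
  rw [ae_iff]
  simpa using h5

/-- Undo `u = 1/(1 + x²)` by taking both roots `x = ±√(1/u - 1)` with equal weight. -/
theorem cauchyTransform_symmetrization {τ : Measure ℝ} [IsFiniteMeasure τ]
    (hτ : ∀ᵐ u ∂τ, u ∈ Set.Icc (0 : ℝ) 1) (hτ0 : ∀ᵐ u ∂τ, u ≠ 0) {z : ℂ} (hz : 0 < z.im) :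
    cauchyTransform ((1 / 2 : ℝ≥0∞) • (τ.map (fun u => √(1 / u - 1))
      + τ.map (fun u => -√(1 / u - 1)))) z
      = -z * ∫ u : ℝ, (u : ℂ) / (1 + (-z ^ 2 - 1) * u) ∂τ := by
  have hm : Measurable (fun u : ℝ => √(1 / u - 1)) := by fun_prop
  have hm' : Measurable (fun u : ℝ => -√(1 / u - 1)) := hm.neg
  have hi1 : Integrable (fun u : ℝ => (z - ((√(1 / u - 1) : ℝ) : ℂ))⁻¹) τ :=
    Integrable.of_bound (Measurable.aestronglyMeasurable (by fun_prop)) z.im⁻¹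
      (Eventually.of_forall fun u => norm_sub_ofReal_inv_le hz _)
  have hi2 : Integrable (fun u : ℝ => (z - ((-√(1 / u - 1) : ℝ) : ℂ))⁻¹) τ :=
    Integrable.of_bound (Measurable.aestronglyMeasurable (by fun_prop)) z.im⁻¹
      (Eventually.of_forall fun u => norm_sub_ofReal_inv_le hz _)
  unfold cauchyTransform
  rw [integral_smul_measure, integral_add_measure (integrable_sub_ofReal_inv _ hz)
    (integrable_sub_ofReal_inv _ hz),
    integral_map hm.aemeasurable (Measurable.aestronglyMeasurable (by fun_prop)),
    integral_map hm'.aemeasurable (Measurable.aestronglyMeasurable (by fun_prop)),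
    ← integral_add hi1 hi2, ← integral_const_mul, ← integral_smul]
  apply integral_congr_ae
  filter_upwards [hτ, hτ0] with u hu hu0
  have hupos : 0 < u := lt_of_le_of_ne hu.1 hu0.symm
  have hsq : (√(1 / u - 1)) ^ 2 = 1 / u - 1 := Real.sq_sqrt (by
    rw [sub_nonneg, le_div_iff₀ hupos]; linarith [hu.2])
  rw [inv_sub_add_inv_add hz, ← Complex.ofReal_pow, hsq]
  have hne := one_add_mul_ne_zero (neg_sq_mem_slitPlane hz) hu
  have h1 : (((1 / u - 1 : ℝ) : ℂ) + -z ^ 2)⁻¹ = (u : ℂ) / (1 + (-z ^ 2 - 1) * u) := by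
    have hu' : (u : ℂ) ≠ 0 := by exact_mod_cast hu0
    have : ((1 / u - 1 : ℝ) : ℂ) + -z ^ 2 = (1 + (-z ^ 2 - 1) * u) / u := by
      push_cast
      field_simp
      ring
    rw [this, inv_div]
  rw [h1]
  simp only [one_div, ENNReal.toReal_inv, ENNReal.toReal_ofNat, Complex.real_smul,
    Complex.ofReal_inv, Complex.ofReal_ofNat]
  ring

/-- Existence of Boolean convolution powers of symmetric probability measures. -/
theorem exists_selfEnergy_eq_nat_mul {μ : Measure ℝ} [IsProbabilityMeasure μ]
    (hsymm : μ.map (fun x : ℝ => -x) = μ) {n : ℕ} (hn : 1 ≤ n) :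
    ∃ ν : Measure ℝ, IsProbabilityMeasure ν ∧
      ∀ z : ℂ, 0 < z.im → selfEnergy ν z = n * selfEnergy μ z := by
  have hn0 : (0 : ℝ) < n := by exact_mod_cast hn
  set c : ℝ := 1 - 1 / n with hc
  have hc0 : 0 ≤ c := by
    rw [hc, sub_nonneg, div_le_one hn0]; exact_mod_cast hn
  have hc1 : c < 1 := by rw [hc]; linarith [div_pos one_pos hn0]
  obtain ⟨τ, hfin, hτ, hmass, hint⟩ := exists_measure_integral_resolvent μ hc0 hc1
  have hc1' : (1 : ℂ) - c ≠ 0 := by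
    have : 1 - c ≠ 0 := by linarith
    exact_mod_cast this
  -- Since `t S(t) → 1`, also `t (1 - c) S / (1 - c t S) → (1 - c)/(1 - c) = 1`.
  have hτ0 : ∀ᵐ u ∂τ, u ≠ 0 := by
    apply ae_ne_zero_of_tendsto hτ hmass
    have h1 := tendsto_mul_integral_sq_add_inv μ
    have h2 := (h1.const_mul (c : ℂ)).const_sub 1
    rw [mul_one] at h2
    have h3 := (h1.const_mul (1 - c : ℂ)).div h2 hc1'
    rw [mul_one, div_self hc1'] at h3
    refine h3.congr' ?_
    filter_upwards [h2.eventually_ne hc1'] with k hk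
    have hk' : ((k : ℂ) + 1) ∈ Complex.slitPlane := by
      rw [Complex.mem_slitPlane_iff]; left; simp; positivity
    have hk2 : 1 - ((k : ℂ) + 1) * c * ∫ x : ℝ, ((x : ℂ) ^ 2 + ((k : ℂ) + 1))⁻¹ ∂μ ≠ 0 := by
      convert hk using 1; ring
    rw [hint _ hk' _ rfl hk2]
    simp only [Pi.div_apply]
    rw [← mul_div_assoc]
    congr 1 <;> ring
  refine ⟨(1 / 2 : ℝ≥0∞) • (τ.map (fun u => √(1 / u - 1)) + τ.map (fun u => -√(1 / u - 1))),
    ⟨?_⟩, fun z hz => ?_⟩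
  · have hτ1 : τ Set.univ = 1 := by
      rw [← ofReal_measureReal (μ := τ), hmass, ENNReal.ofReal_one]
    rw [Measure.smul_apply, Measure.add_apply, Measure.map_apply (by fun_prop) MeasurableSet.univ,
      Measure.map_apply (by fun_prop) MeasurableSet.univ, Set.preimage_univ, Set.preimage_univ, hτ1]
    rw [one_add_one_eq_two, smul_eq_mul, one_div, ENNReal.inv_mul_cancel (by simp) (by simp)]
  · have hG := cauchyTransform_of_symm hsymm hz
    have hG0 := cauchyTransform_ne_zero μ hz
    have hne := one_sub_mul_cauchyTransform_ne_zero μ hz hc1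
    set S := ∫ x : ℝ, ((x : ℂ) ^ 2 + -z ^ 2)⁻¹ ∂μ with hS
    have hS0 : S ≠ 0 := by
      intro h; rw [h, mul_zero] at hG; exact hG0 hG
    have hne' : 1 - -z ^ 2 * c * S ≠ 0 := by
      convert hne using 1; rw [hG]; ring
    have hz0 : z ≠ 0 := by
      intro h; rw [h] at hz; simp at hz
    have hcn : (1 : ℂ) - c = 1 / n := by
      rw [hc]; push_cast; ring
    have hn' : (n : ℂ) ≠ 0 := by exact_mod_cast hn0.ne'
    have hc' : (c : ℂ) = 1 - 1 / n := by rw [hc]; push_cast; ring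
    unfold selfEnergy
    rw [cauchyTransform_symmetrization hτ hτ0 hz, hint _ (neg_sq_mem_slitPlane hz) S hS.symm hne',
      hG, hcn, mul_inv, inv_div, mul_inv, hc']
    field_simp
    ring

theorem selfEnergy_dirac_zero {z : ℂ} : selfEnergy (Measure.dirac 0) z = 0 := by
  simp [selfEnergy, cauchyTransform]

theorem booleanPow_spec {μ : Measure ℝ} [IsProbabilityMeasure μ]
    (hsymm : μ.map (fun x : ℝ => -x) = μ) (n : ℕ) :
    IsProbabilityMeasure (booleanPow μ n) ∧
      ∀ z : ℂ, 0 < z.im → selfEnergy (booleanPow μ n) z = n * selfEnergy μ z := by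
  induction n with
  | zero =>
    refine ⟨by unfold booleanPow; infer_instance, fun z _ => ?_⟩
    simp [booleanPow, selfEnergy_dirac_zero]
  | succ n ih =>
    -- Existence excludes the default value `0` of `booleanConv`. Uniqueness is not needed: only the
    -- self-energy of the chosen measure is used later.
    have hex : ∃ ρ : Measure ℝ, IsBooleanConv (booleanPow μ n) μ ρ := by
      obtain ⟨ν, hν, h⟩ := exists_selfEnergy_eq_nat_mul hsymm (Nat.le_add_left 1 n)
      refine ⟨ν, hν, fun z hz => ?_⟩
      rw [h z hz, ih.2 z hz]
      push_cast
      ring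
    have h := hex.choose_spec
    have heq : booleanPow μ (n + 1) = hex.choose := by
      simp only [booleanPow, booleanConv, dif_pos hex]
    rw [heq]
    refine ⟨h.1, fun z hz => ?_⟩
    rw [h.2 z hz, ih.2 z hz]
    push_cast
    ring

end BooleanPower

/-! ### Monotone convergence along resolvent truncations -/

section MonotoneLimits

theorem tendsto_lintegral_of_monotone {ν : Measure ℝ} {f : ℕ → ℝ → ℝ} {g : ℝ → ℝ≥0∞}
    (hm : ∀ k, Measurable (f k)) (hmono : ∀ x, Monotone fun k => f k x)
    (hlim : ∀ x, Tendsto (fun k => ENNReal.ofReal (f k x)) atTop (nhds (g x))) :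
    Tendsto (fun k => ∫⁻ x, ENNReal.ofReal (f k x) ∂ν) atTop (nhds (∫⁻ x, g x ∂ν)) :=
  lintegral_tendsto_of_tendsto_of_monotone (fun k => (hm k).ennreal_ofReal.aemeasurable)
    (Eventually.of_forall fun x _ _ h => ENNReal.ofReal_le_ofReal (hmono x h))
    (Eventually.of_forall hlim)

theorem lintegral_eq_of_tendsto_of_monotone {ν : Measure ℝ} {f : ℕ → ℝ → ℝ} {g : ℝ → ℝ≥0∞} {L : ℝ}
    (hm : ∀ k, Measurable (f k)) (hi : ∀ k, Integrable (f k) ν) (h0 : ∀ k x, 0 ≤ f k x)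
    (hmono : ∀ x, Monotone fun k => f k x)
    (hlim : ∀ x, Tendsto (fun k => ENNReal.ofReal (f k x)) atTop (nhds (g x)))
    (hL : Tendsto (fun k => ∫ x, f k x ∂ν) atTop (nhds L)) :
    ∫⁻ x, g x ∂ν = ENNReal.ofReal L := by
  refine tendsto_nhds_unique (tendsto_lintegral_of_monotone hm hmono hlim) ?_
  refine ((ENNReal.continuous_ofReal.tendsto L).comp hL).congr fun k => ?_
  exact ofReal_integral_eq_lintegral_ofReal (hi k) (Eventually.of_forall (h0 k))

theorem integrable_and_integral_eq_of_tendsto_of_monotone {ν : Measure ℝ} {f : ℕ → ℝ → ℝ}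
    {F : ℝ → ℝ} {L : ℝ} (hF : Measurable F) (hF0 : ∀ x, 0 ≤ F x)
    (hm : ∀ k, Measurable (f k)) (hi : ∀ k, Integrable (f k) ν) (h0 : ∀ k x, 0 ≤ f k x)
    (hmono : ∀ x, Monotone fun k => f k x)
    (hlim : ∀ x, Tendsto (fun k => f k x) atTop (nhds (F x)))
    (hL : Tendsto (fun k => ∫ x, f k x ∂ν) atTop (nhds L)) :
    Integrable F ν ∧ ∫ x, F x ∂ν = L := by
  have h := lintegral_eq_of_tendsto_of_monotone hm hi h0 hmono
    (fun x => (ENNReal.continuous_ofReal.tendsto _).comp (hlim x)) hL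
  refine ⟨⟨hF.aestronglyMeasurable, ?_⟩, ?_⟩
  · rw [hasFiniteIntegral_iff_ofReal (Eventually.of_forall hF0), h]
    exact ENNReal.ofReal_lt_top
  · rw [integral_eq_lintegral_of_nonneg_ae (Eventually.of_forall hF0) hF.aestronglyMeasurable, h]
    exact ENNReal.toReal_ofReal
      (ge_of_tendsto hL (Eventually.of_forall fun k => integral_nonneg (h0 k)))

end MonotoneLimits

/-! ### The Stieltjes transform of the law of `x²` -/

section ResolventMoment

/-- The Stieltjes transform `∫ (x² + t)⁻¹ dm(x)` of the law of `x²`, for `t > 0`. -/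
noncomputable def resolventMoment (m : Measure ℝ) (t : ℝ) : ℝ := ∫ x : ℝ, (x ^ 2 + t)⁻¹ ∂m

variable {m : Measure ℝ} [IsProbabilityMeasure m]

theorem integrable_sq_add_inv {t : ℝ} (ht : 0 < t) :
    Integrable (fun x : ℝ => (x ^ 2 + t)⁻¹) m := by
  refine Integrable.of_bound (Measurable.aestronglyMeasurable (by fun_prop)) t⁻¹
    (Eventually.of_forall fun x => ?_)
  rw [Real.norm_of_nonneg (by positivity)]
  exact inv_anti₀ ht (by nlinarith [sq_nonneg x])

theorem resolventMoment_pos {t : ℝ} (ht : 0 < t) : 0 < resolventMoment m t := by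
  unfold resolventMoment
  rw [integral_pos_iff_support_of_nonneg]
  · have : Function.support (fun x : ℝ => (x ^ 2 + t)⁻¹) = Set.univ := by
      ext x
      have : x ^ 2 + t ≠ 0 := by positivity
      simp [this]
    rw [this]
    simp
  · intro x
    simp only [Pi.zero_apply]
    positivity
  · exact integrable_sq_add_inv ht

theorem mul_resolventMoment_le_one {t : ℝ} (ht : 0 < t) : t * resolventMoment m t ≤ 1 := by
  have h : resolventMoment m t ≤ ∫ _ : ℝ, t⁻¹ ∂m := by
    refine integral_mono (integrable_sq_add_inv ht) (integrable_const _) fun x => ?_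
    exact inv_anti₀ ht (by nlinarith [sq_nonneg x])
  simp only [integral_const, probReal_univ, one_smul] at h
  rw [← mul_inv_cancel₀ ht.ne']
  exact mul_le_mul_of_nonneg_left h ht.le

theorem integrable_sq_mul_div {t : ℝ} (ht : 0 < t) :
    Integrable (fun x : ℝ => x ^ 2 * (t / (x ^ 2 + t))) m := by
  refine Integrable.of_bound (Measurable.aestronglyMeasurable (by fun_prop)) t
    (Eventually.of_forall fun x => ?_)
  rw [Real.norm_of_nonneg (by positivity), ← mul_div_assoc, div_le_iff₀ (by positivity)]
  nlinarith [sq_nonneg x]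

theorem integral_sq_mul_div {t : ℝ} (ht : 0 < t) :
    ∫ x : ℝ, x ^ 2 * (t / (x ^ 2 + t)) ∂m = t * (1 - t * resolventMoment m t) := by
  have h : ∀ x : ℝ, x ^ 2 * (t / (x ^ 2 + t)) = t * (1 - t * (x ^ 2 + t)⁻¹) := by
    intro x
    have : x ^ 2 + t ≠ 0 := by positivity
    field_simp
    ring
  simp_rw [h]
  rw [integral_const_mul, integral_sub (integrable_const _) ((integrable_sq_add_inv ht).const_mul _),
    integral_const_mul]
  simp [resolventMoment]

omit [IsProbabilityMeasure m] in
theorem integrable_pow_four_mul_div (h2 : Integrable (fun x : ℝ => x ^ 2) m) {t : ℝ} (ht : 0 < t) :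
    Integrable (fun x : ℝ => x ^ 4 * (t / (x ^ 2 + t))) m := by
  refine (h2.const_mul t).mono' (Measurable.aestronglyMeasurable (by fun_prop))
    (Eventually.of_forall fun x => ?_)
  rw [Real.norm_of_nonneg (by positivity), ← mul_div_assoc, div_le_iff₀ (by positivity)]
  nlinarith [sq_nonneg x, mul_nonneg ht.le (sq_nonneg x), mul_nonneg (mul_nonneg ht.le ht.le) (sq_nonneg x)]

theorem integral_pow_four_mul_div (h2 : Integrable (fun x : ℝ => x ^ 2) m) {t : ℝ} (ht : 0 < t) :
    ∫ x : ℝ, x ^ 4 * (t / (x ^ 2 + t)) ∂m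
      = t * (∫ x, x ^ 2 ∂m - t * (1 - t * resolventMoment m t)) := by
  have h : ∀ x : ℝ, x ^ 4 * (t / (x ^ 2 + t)) = t * (x ^ 2 - x ^ 2 * (t / (x ^ 2 + t))) := by
    intro x
    have : x ^ 2 + t ≠ 0 := by positivity
    field_simp
    ring
  simp_rw [h]
  rw [integral_const_mul, integral_sub h2 (integrable_sq_mul_div ht), integral_sq_mul_div ht]

theorem monotone_div_sq_add (x : ℝ) :
    Monotone fun k : ℕ => ((k : ℝ) + 1) / (x ^ 2 + ((k : ℝ) + 1)) := by
  intro j k hjk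
  have : (j : ℝ) ≤ k := by exact_mod_cast hjk
  simp only
  rw [div_le_div_iff₀ (by positivity) (by positivity)]
  nlinarith [mul_le_mul_of_nonneg_right this (sq_nonneg x)]

omit [IsProbabilityMeasure m] in
theorem tendsto_integral_mul_div {p : ℕ} (hp : Even p) (hi : Integrable (fun x : ℝ => x ^ p) m)
    (hik : ∀ k : ℕ, Integrable (fun x : ℝ => x ^ p * (((k : ℝ) + 1) / (x ^ 2 + ((k : ℝ) + 1)))) m) :
    Tendsto (fun k : ℕ => ∫ x : ℝ, x ^ p * (((k : ℝ) + 1) / (x ^ 2 + ((k : ℝ) + 1))) ∂m) atTop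
      (nhds (∫ x, x ^ p ∂m)) := by
  refine integral_tendsto_of_tendsto_of_monotone hik hi ?_ ?_
  · exact Eventually.of_forall fun x =>
      (monotone_div_sq_add x).const_mul (hp.pow_nonneg x)
  · refine Eventually.of_forall fun x => ?_
    simpa using (tendsto_div_sq_add x).const_mul (x ^ p)

-- The weights `t/(x² + t)` increase to `1`, so convergence of the truncated moments yields
-- integrability as well as the value.
omit [IsProbabilityMeasure m] in
theorem integral_pow_eq_of_tendsto {p : ℕ} (hp : Even p) {L : ℝ}
    (hik : ∀ k : ℕ, Integrable (fun x : ℝ => x ^ p * (((k : ℝ) + 1) / (x ^ 2 + ((k : ℝ) + 1)))) m)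
    (hL : Tendsto (fun k : ℕ => ∫ x : ℝ, x ^ p * (((k : ℝ) + 1) / (x ^ 2 + ((k : ℝ) + 1))) ∂m) atTop
      (nhds L)) :
    Integrable (fun x : ℝ => x ^ p) m ∧ ∫ x, x ^ p ∂m = L := by
  refine integrable_and_integral_eq_of_tendsto_of_monotone (by fun_prop) (fun x => hp.pow_nonneg x)
    (fun k => by fun_prop) hik (fun k x => ?_) (fun x => ?_) (fun x => ?_) hL
  · exact mul_nonneg (hp.pow_nonneg x) (by positivity)
  · exact (monotone_div_sq_add x).const_mul (hp.pow_nonneg x)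
  · simpa using (tendsto_div_sq_add x).const_mul (x ^ p)

theorem monotone_sq_add_inv (x : ℝ) :
    Monotone fun k : ℕ => (x ^ 2 + ((k : ℝ) + 1)⁻¹)⁻¹ := by
  intro j k hjk
  have : (j : ℝ) ≤ k := by exact_mod_cast hjk
  exact inv_anti₀ (by positivity)
    (add_le_add_right (inv_anti₀ (by positivity) (by linarith)) _)

/-- At `x = 0` the limit is `⊤`, so an atom at `0` is detected by the inverse moment. -/
theorem tendsto_ofReal_sq_add_inv (x : ℝ) :
    Tendsto (fun k : ℕ => ENNReal.ofReal (x ^ 2 + ((k : ℝ) + 1)⁻¹)⁻¹) atTop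
      (nhds (‖x‖ₑ ^ 2)⁻¹) := by
  have h1 : Tendsto (fun k : ℕ => x ^ 2 + ((k : ℝ) + 1)⁻¹) atTop (nhds (x ^ 2 + 0)) :=
    tendsto_const_nhds.add (tendsto_inv_atTop_zero.comp
      (tendsto_atTop_add_const_right _ _ tendsto_natCast_atTop_atTop))
  have h2 := tendsto_inv_iff.mpr ((ENNReal.continuous_ofReal.tendsto _).comp h1)
  have h3 : ENNReal.ofReal (x ^ 2 + 0) = ‖x‖ₑ ^ 2 := by
    rw [add_zero, ← sq_abs, ENNReal.ofReal_pow (abs_nonneg x), ← Real.norm_eq_abs, ofReal_norm]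
  rw [h3] at h2
  refine h2.congr fun k => ?_
  exact (ENNReal.ofReal_inv_of_pos (by positivity)).symm

omit [IsProbabilityMeasure m] in
theorem tendsto_resolventMoment (h : ∫⁻ x : ℝ, (‖x‖ₑ ^ 2)⁻¹ ∂m < ⊤) :
    Tendsto (fun k : ℕ => resolventMoment m ((k : ℝ) + 1)⁻¹) atTop
      (nhds (∫⁻ x : ℝ, (‖x‖ₑ ^ 2)⁻¹ ∂m).toReal) := by
  have h1 := tendsto_lintegral_of_monotone (ν := m)
    (f := fun k x => (x ^ 2 + ((k : ℝ) + 1)⁻¹)⁻¹) (fun k => by fun_prop) monotone_sq_add_inv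
    tendsto_ofReal_sq_add_inv
  refine ((ENNReal.tendsto_toReal h.ne).comp h1).congr fun k => ?_
  exact (integral_eq_lintegral_of_nonneg_ae (Eventually.of_forall fun x => by positivity)
    (Measurable.aestronglyMeasurable (by fun_prop))).symm

theorem lintegral_inv_sq_eq_of_tendsto {L : ℝ}
    (hL : Tendsto (fun k : ℕ => resolventMoment m ((k : ℝ) + 1)⁻¹) atTop (nhds L)) :
    ∫⁻ x : ℝ, (‖x‖ₑ ^ 2)⁻¹ ∂m = ENNReal.ofReal L :=
  lintegral_eq_of_tendsto_of_monotone (f := fun k x => (x ^ 2 + ((k : ℝ) + 1)⁻¹)⁻¹)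
    (fun k => by fun_prop) (fun k => integrable_sq_add_inv (by positivity))
    (fun k x => by positivity) monotone_sq_add_inv tendsto_ofReal_sq_add_inv hL

theorem im_cauchyTransform_I_mul {y : ℝ} (hy : 0 < y) :
    (cauchyTransform m (Complex.I * y)).im = -y * resolventMoment m (y ^ 2) := by
  have hz : 0 < (Complex.I * (y : ℂ)).im := by simpa using hy
  have h1 : (cauchyTransform m (Complex.I * y)).im
      = ∫ x : ℝ, ((Complex.I * (y : ℂ) - (x : ℂ))⁻¹).im ∂m :=
    (integral_im (integrable_sub_ofReal_inv m hz)).symm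
  rw [h1, resolventMoment, ← integral_const_mul]
  refine integral_congr_ae (Eventually.of_forall fun x => ?_)
  simp only [Complex.inv_im, Complex.normSq_apply]
  simp
  ring

theorem cauchyTransform_I_mul_of_symm (hsymm : m.map (fun x : ℝ => -x) = m) {y : ℝ} (hy : 0 < y) :
    cauchyTransform m (Complex.I * y) = -Complex.I * (y * resolventMoment m (y ^ 2) : ℝ) := by
  have hz : 0 < (Complex.I * (y : ℂ)).im := by simpa using hy
  rw [cauchyTransform_of_symm hsymm hz]
  have : ∫ x : ℝ, ((x : ℂ) ^ 2 + -(Complex.I * (y : ℂ)) ^ 2)⁻¹ ∂m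
      = ((resolventMoment m (y ^ 2) : ℝ) : ℂ) := by
    rw [resolventMoment, ← integral_complex_ofReal]
    refine integral_congr_ae (Eventually.of_forall fun x => ?_)
    simp only [mul_pow, Complex.I_sq]
    push_cast
    ring
  rw [this]
  push_cast
  ring

/-- Evaluate the self-energy equation at `i√t`. Symmetry is used for `μ` only; for `ν` the imaginary
part of `G_ν(i√t)` already gives `J_ν(t)`. -/
theorem resolventMoment_of_selfEnergy {μ ν : Measure ℝ} [IsProbabilityMeasure μ]
    [IsProbabilityMeasure ν] (hsymm : μ.map (fun x : ℝ => -x) = μ) {n : ℕ} (hn : 1 ≤ n)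
    (hK : ∀ z : ℂ, 0 < z.im → selfEnergy ν z = n * selfEnergy μ z) {t : ℝ} (ht : 0 < t) :
    resolventMoment ν t = resolventMoment μ t / (n - (n - 1) * (t * resolventMoment μ t)) := by
  obtain ⟨y, hy, rfl⟩ : ∃ y : ℝ, 0 < y ∧ y ^ 2 = t := ⟨√t, Real.sqrt_pos.mpr ht, Real.sq_sqrt ht.le⟩
  have hz : 0 < (Complex.I * (y : ℂ)).im := by simpa using hy
  have h := hK _ hz
  have hν := im_cauchyTransform_I_mul (m := ν) hy
  have hG0 := cauchyTransform_ne_zero ν hz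
  have hJ := resolventMoment_pos (m := μ) ht
  have hJ1 := mul_resolventMoment_le_one (m := μ) ht
  unfold selfEnergy at h
  rw [cauchyTransform_I_mul_of_symm hsymm hy] at h
  set G := cauchyTransform ν (Complex.I * y)
  set J := resolventMoment μ (y ^ 2)
  have hn' : (1 : ℝ) ≤ n := by exact_mod_cast hn
  have hden : 0 < n - (n - 1) * (y ^ 2 * J) := by nlinarith
  have h1 : G⁻¹ = Complex.I * ((n - (n - 1) * (y ^ 2 * J)) / (y * J) : ℝ) := by
    have hyC : (y : ℂ) ≠ 0 := by exact_mod_cast hy.ne'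
    have hJC : (J : ℂ) ≠ 0 := by exact_mod_cast hJ.ne'
    have hI : (-Complex.I * ((y * J : ℝ) : ℂ))⁻¹ = Complex.I * ((y * J)⁻¹ : ℝ) := by
      rw [mul_inv, inv_neg, Complex.inv_I, neg_neg]; push_cast; rfl
    rw [hI] at h
    have : G⁻¹ = Complex.I * y - n * (Complex.I * y - Complex.I * ((y * J)⁻¹ : ℝ)) := by
      rw [← h]; ring
    rw [this]
    push_cast
    field_simp
    ring
  have h2 : G = -Complex.I * ((y * J) / (n - (n - 1) * (y ^ 2 * J)) : ℝ) := by
    rw [← inv_inv G, h1, mul_inv, Complex.inv_I, ← Complex.ofReal_inv, inv_div]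
  rw [h2] at hν
  simp only [neg_mul, Complex.neg_im, Complex.I_mul_im, Complex.ofReal_re] at hν
  have h3 : y * resolventMoment ν (y ^ 2) = y * (J / (n - (n - 1) * (y ^ 2 * J))) := by
    rw [← mul_div_assoc]; linarith
  exact mul_left_cancel₀ hy.ne' h3

end ResolventMoment

/-! ### Moments of Boolean powers -/

section Moments

variable {μ ν : Measure ℝ} [IsProbabilityMeasure μ] [IsProbabilityMeasure ν]

theorem tendsto_natCast_add_one_inv : Tendsto (fun k : ℕ => ((k : ℝ) + 1)⁻¹) atTop (nhds 0) :=
  tendsto_inv_atTop_zero.comp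
    (tendsto_atTop_add_const_right _ _ tendsto_natCast_atTop_atTop)

theorem moment_two_of_selfEnergy (hsymm : μ.map (fun x : ℝ => -x) = μ)
    (hm2i : Integrable (fun x : ℝ => x ^ 2) μ) (hm2 : ∫ x : ℝ, x ^ 2 ∂μ = 1) {n : ℕ} (hn : 1 ≤ n)
    (hK : ∀ z : ℂ, 0 < z.im → selfEnergy ν z = n * selfEnergy μ z) :
    Integrable (fun x : ℝ => x ^ 2) ν ∧ ∫ x : ℝ, x ^ 2 ∂ν = n := by
  have hpos : ∀ k : ℕ, (0 : ℝ) < (k : ℝ) + 1 := fun k => by positivity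
  have hn' : (1 : ℝ) ≤ n := by exact_mod_cast hn
  refine integral_pow_eq_of_tendsto even_two (fun k => integrable_sq_mul_div (hpos k)) ?_
  have hP := tendsto_integral_mul_div even_two hm2i (fun k => integrable_sq_mul_div (hpos k))
  rw [hm2] at hP
  -- With `P = t (1 - t J_μ)` the truncated second moment of `ν` is `n P / (1 + (n - 1) P / t)`,
  -- where `P → 1`.
  have hlim := (hP.const_mul (n : ℝ)).div
    (((hP.mul tendsto_natCast_add_one_inv).const_mul ((n : ℝ) - 1)).const_add 1) (by simp)
  simp only [mul_one, mul_zero, add_zero, div_one] at hlim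
  refine hlim.congr fun k => ?_
  have hJ1 := mul_resolventMoment_le_one (m := μ) (hpos k)
  simp only [Pi.div_apply]
  rw [integral_sq_mul_div (hpos k), integral_sq_mul_div (hpos k),
    resolventMoment_of_selfEnergy hsymm hn hK (hpos k)]
  have hk := (hpos k).ne'
  generalize (k : ℝ) + 1 = t at *
  set J := resolventMoment μ t
  have h1 : (n : ℝ) - (n - 1) * (t * J) ≠ 0 := by nlinarith
  have h2 : 1 + ((n : ℝ) - 1) * (t * (1 - t * J) * t⁻¹) = n - (n - 1) * (t * J) := by
    field_simp; ring
  rw [h2]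
  obtain ⟨d, hd⟩ : ∃ d : ℝ, d = n - (n - 1) * (t * J) := ⟨_, rfl⟩
  rw [← hd] at h1 ⊢
  field_simp
  rw [hd]
  ring

theorem moment_four_of_selfEnergy (hsymm : μ.map (fun x : ℝ => -x) = μ)
    (hm2i : Integrable (fun x : ℝ => x ^ 2) μ) (hm2 : ∫ x : ℝ, x ^ 2 ∂μ = 1)
    (hm4 : Integrable (fun x : ℝ => x ^ 4) μ) {n : ℕ} (hn : 1 ≤ n)
    (hK : ∀ z : ℂ, 0 < z.im → selfEnergy ν z = n * selfEnergy μ z) :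
    Integrable (fun x : ℝ => x ^ 4) ν ∧
      ∫ x : ℝ, x ^ 4 ∂ν = n * (∫ x : ℝ, x ^ 4 ∂μ + (n - 1)) := by
  have hpos : ∀ k : ℕ, (0 : ℝ) < (k : ℝ) + 1 := fun k => by positivity
  have hn' : (1 : ℝ) ≤ n := by exact_mod_cast hn
  obtain ⟨hν2i, hν2⟩ := moment_two_of_selfEnergy hsymm hm2i hm2 hn hK
  have h4 : Even 4 := by decide
  refine integral_pow_eq_of_tendsto h4 (fun k => integrable_pow_four_mul_div hν2i (hpos k)) ?_
  have hP := tendsto_integral_mul_div even_two hm2i (fun k => integrable_sq_mul_div (hpos k))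
  have hQ := tendsto_integral_mul_div h4 hm4 (fun k => integrable_pow_four_mul_div hm2i (hpos k))
  rw [hm2] at hP
  -- With also `Q = t (1 - P)`, the truncated fourth moment of `ν` is `n (Q + (n - 1) P) / (1 + (n -
  -- 1) P / t)`.
  have hlim := ((hQ.add (hP.const_mul ((n : ℝ) - 1))).const_mul (n : ℝ)).div
    (((hP.mul tendsto_natCast_add_one_inv).const_mul ((n : ℝ) - 1)).const_add 1) (by simp)
  simp only [mul_one, mul_zero, add_zero, div_one] at hlim
  refine hlim.congr fun k => ?_
  have hJ1 := mul_resolventMoment_le_one (m := μ) (hpos k)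
  simp only [Pi.div_apply]
  rw [integral_sq_mul_div (hpos k), integral_pow_four_mul_div hm2i (hpos k),
    integral_pow_four_mul_div hν2i (hpos k), hm2, hν2,
    resolventMoment_of_selfEnergy hsymm hn hK (hpos k)]
  have hk := (hpos k).ne'
  generalize (k : ℝ) + 1 = t at *
  set J := resolventMoment μ t
  have h1 : (n : ℝ) - (n - 1) * (t * J) ≠ 0 := by nlinarith
  have h2 : 1 + ((n : ℝ) - 1) * (t * (1 - t * J) * t⁻¹) = n - (n - 1) * (t * J) := by
    field_simp; ring
  rw [h2]
  obtain ⟨d, hd⟩ : ∃ d : ℝ, d = n - (n - 1) * (t * J) := ⟨_, rfl⟩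
  rw [← hd] at h1 ⊢
  field_simp
  rw [hd]
  ring

/-- As `t → 0` the term `t J_μ(t)` vanishes, leaving `J_μ / n`. -/
theorem inv_moment_of_selfEnergy (hsymm : μ.map (fun x : ℝ => -x) = μ)
    (hmneg2 : ∫⁻ x : ℝ, (‖x‖ₑ ^ 2)⁻¹ ∂μ < ⊤) {n : ℕ} (hn : 1 ≤ n)
    (hK : ∀ z : ℂ, 0 < z.im → selfEnergy ν z = n * selfEnergy μ z) :
    ∫⁻ x : ℝ, (‖x‖ₑ ^ 2)⁻¹ ∂ν
      = ENNReal.ofReal ((∫⁻ x : ℝ, (‖x‖ₑ ^ 2)⁻¹ ∂μ).toReal / n) := by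
  have hn' : (1 : ℝ) ≤ n := by exact_mod_cast hn
  apply lintegral_inv_sq_eq_of_tendsto
  have hJ := tendsto_resolventMoment hmneg2
  have hlim := hJ.div (((tendsto_natCast_add_one_inv.mul hJ).const_mul
    ((n : ℝ) - 1)).const_sub (n : ℝ)) (by simp; omega)
  simp only [zero_mul, mul_zero, sub_zero] at hlim
  refine hlim.congr fun k => ?_
  rw [resolventMoment_of_selfEnergy hsymm hn hK (by positivity)]
  rfl

end Moments

/-! ### Entropy as an integral, and its upper bound -/

section Entropy

variable {ν : Measure ℝ} [IsProbabilityMeasure ν]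

theorem enorm_sq_eq_ofReal (x : ℝ) : ‖x‖ₑ ^ 2 = ENNReal.ofReal (x ^ 2) := by
  rw [← sq_abs, ENNReal.ofReal_pow (abs_nonneg x), ← Real.norm_eq_abs, ofReal_norm]

omit [IsProbabilityMeasure ν] in
theorem ae_ne_zero_of_lintegral_inv_sq (h : ∫⁻ x : ℝ, (‖x‖ₑ ^ 2)⁻¹ ∂ν < ⊤) :
    ∀ᵐ x ∂ν, x ≠ 0 := by
  filter_upwards [ae_lt_top (by fun_prop) h.ne] with x hx h0
  simp [h0] at hx

omit [IsProbabilityMeasure ν] in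
theorem ofReal_inv_sq_ae_eq (h : ∫⁻ x : ℝ, (‖x‖ₑ ^ 2)⁻¹ ∂ν < ⊤) :
    (fun x : ℝ => ENNReal.ofReal (x ^ 2)⁻¹) =ᵐ[ν] fun x => (‖x‖ₑ ^ 2)⁻¹ := by
  filter_upwards [ae_ne_zero_of_lintegral_inv_sq h] with x hx
  rw [enorm_sq_eq_ofReal, ENNReal.ofReal_inv_of_pos (by positivity)]

omit [IsProbabilityMeasure ν] in
theorem integrable_inv_sq (h : ∫⁻ x : ℝ, (‖x‖ₑ ^ 2)⁻¹ ∂ν < ⊤) :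
    Integrable (fun x : ℝ => (x ^ 2)⁻¹) ν := by
  refine ⟨Measurable.aestronglyMeasurable (by fun_prop), ?_⟩
  rw [hasFiniteIntegral_iff_ofReal (Eventually.of_forall fun x => by positivity),
    lintegral_congr_ae (ofReal_inv_sq_ae_eq h)]
  exact h

omit [IsProbabilityMeasure ν] in
theorem integral_inv_sq (h : ∫⁻ x : ℝ, (‖x‖ₑ ^ 2)⁻¹ ∂ν < ⊤) :
    ∫ x : ℝ, (x ^ 2)⁻¹ ∂ν = (∫⁻ x : ℝ, (‖x‖ₑ ^ 2)⁻¹ ∂ν).toReal := by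
  rw [integral_eq_lintegral_of_nonneg_ae (Eventually.of_forall fun x => by positivity)
    (Measurable.aestronglyMeasurable (by fun_prop)), lintegral_congr_ae (ofReal_inv_sq_ae_eq h)]

omit [IsProbabilityMeasure ν] in
theorem integrable_log (h2 : Integrable (fun x : ℝ => x ^ 2) ν)
    (h : ∫⁻ x : ℝ, (‖x‖ₑ ^ 2)⁻¹ ∂ν < ⊤) : Integrable Real.log ν := by
  refine (h2.add (integrable_inv_sq h)).mono' Real.measurable_log.aestronglyMeasurable ?_
  filter_upwards [ae_ne_zero_of_lintegral_inv_sq h] with x hx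
  have hx2 : 0 < x ^ 2 := by positivity
  have h1 := Real.log_le_sub_one_of_pos hx2
  have h2 := Real.log_le_sub_one_of_pos (inv_pos.mpr hx2)
  rw [Real.log_inv] at h2
  rw [Real.log_pow] at h1 h2
  push_cast at h1 h2
  have h3 : 0 < (x ^ 2)⁻¹ := inv_pos.mpr hx2
  simp only [Pi.add_apply]
  rw [Real.norm_eq_abs, abs_le]
  constructor <;> linarith

theorem log_enorm {x : ℝ} (hx : x ≠ 0) : ENNReal.log ‖x‖ₑ = (Real.log x : EReal) := by
  rw [← ofReal_norm, ENNReal.log_ofReal, if_neg (by simpa using hx), Real.norm_eq_abs,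
    Real.log_abs]

theorem toENNReal_coe_real (a : ℝ) : (a : EReal).toENNReal = ENNReal.ofReal a :=
  EReal.toENNReal_of_ne_top (EReal.coe_ne_top a)

omit [IsProbabilityMeasure ν] in
theorem booleanEntropy_eq_integral (h2 : Integrable (fun x : ℝ => x ^ 2) ν)
    (h : ∫⁻ x : ℝ, (‖x‖ₑ ^ 2)⁻¹ ∂ν < ⊤) :
    booleanEntropy ν = ((∫ x, Real.log x ∂ν : ℝ) : EReal) := by
  have hlog := integrable_log h2 h
  have hne := ae_ne_zero_of_lintegral_inv_sq h
  have e1 : ∫⁻ x : ℝ, (ENNReal.log ‖x‖ₑ).toENNReal ∂ν = ∫⁻ x, ENNReal.ofReal (Real.log x) ∂ν := by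
    refine lintegral_congr_ae ?_
    filter_upwards [hne] with x hx
    rw [log_enorm hx, toENNReal_coe_real]
  have e2 : ∫⁻ x : ℝ, (-ENNReal.log ‖x‖ₑ).toENNReal ∂ν
      = ∫⁻ x, ENNReal.ofReal (-Real.log x) ∂ν := by
    refine lintegral_congr_ae ?_
    filter_upwards [hne] with x hx
    rw [log_enorm hx, ← EReal.coe_neg, toENNReal_coe_real]
  have f1 : ∫⁻ x, ENNReal.ofReal (Real.log x) ∂ν ≠ ⊤ := hlog.lintegral_lt_top.ne
  have f2 : ∫⁻ x, ENNReal.ofReal (-Real.log x) ∂ν ≠ ⊤ := hlog.neg.lintegral_lt_top.ne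
  rw [booleanEntropy, e1, e2, ← EReal.coe_ennreal_toReal f1, ← EReal.coe_ennreal_toReal f2,
    ← EReal.coe_sub, integral_eq_lintegral_pos_part_sub_lintegral_neg_part hlog]

omit [IsProbabilityMeasure ν] in
theorem relBooleanEntropy_eq_integral (h2 : Integrable (fun x : ℝ => x ^ 2) ν)
    (h : ∫⁻ x : ℝ, (‖x‖ₑ ^ 2)⁻¹ ∂ν < ⊤) :
    relBooleanEntropy ν
      = ((1 / 2 * ∫ x, x ^ 2 ∂ν - ∫ x, Real.log x ∂ν - 1 / 2 : ℝ) : EReal) := by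
  have e1 : ((∫⁻ x : ℝ, ‖x‖ₑ ^ 2 ∂ν : ℝ≥0∞) : EReal) = ((∫ x, x ^ 2 ∂ν : ℝ) : EReal) := by
    simp_rw [enorm_sq_eq_ofReal]
    rw [← ofReal_integral_eq_lintegral_ofReal h2 (Eventually.of_forall fun x => by positivity),
      EReal.coe_ennreal_ofReal, max_eq_left (integral_nonneg fun x => by positivity)]
  rw [relBooleanEntropy, e1, booleanEntropy_eq_integral h2 h, EReal.coe_sub, EReal.coe_sub,
    EReal.coe_mul]

theorem integral_log_le (h2 : Integrable (fun x : ℝ => x ^ 2) ν)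
    (h : ∫⁻ x : ℝ, (‖x‖ₑ ^ 2)⁻¹ ∂ν < ⊤) :
    ∫ x, Real.log x ∂ν ≤ 1 / 2 * ∫ x, x ^ 2 ∂ν - 1 / 2 := by
  have hi : Integrable (fun x : ℝ => 1 / 2 * x ^ 2) ν := h2.const_mul _
  have : ∫ x, Real.log x ∂ν ≤ ∫ x, (1 / 2 * x ^ 2 - 1 / 2) ∂ν := by
    refine integral_mono_ae (integrable_log h2 h) (hi.sub (integrable_const _)) ?_
    filter_upwards [ae_ne_zero_of_lintegral_inv_sq h] with x hx
    have h1 := Real.log_le_sub_one_of_pos (show 0 < x ^ 2 by positivity)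
    rw [Real.log_pow] at h1
    push_cast at h1
    linarith
  rw [integral_sub hi (integrable_const _), integral_const_mul] at this
  simpa using this

theorem half_le_log_natCast {n : ℕ} (hn : 2 ≤ n) : 1 / 2 ≤ Real.log n := by
  have h1 := Real.log_two_gt_d9
  have h2 : Real.log 2 ≤ Real.log n := Real.log_le_log (by norm_num) (by exact_mod_cast hn)
  linarith

/-- For `y ≥ 1/2`, `y⁻¹ - 1 = (1 - y) + (1 - y)² y⁻¹` with `y⁻¹ ≤ 2 ≤ 4 log n`. For `y < 1/2`, `-log
y = log n + log (y⁻¹/n)`; here `log n ≤ 4 log n (1 - y)²`, and `log (y⁻¹/n) ≤ y⁻¹/n - 1`. Cutting at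
scale `1/n` is what costs the factor `log n`. -/
theorem neg_log_le {n : ℕ} (hn : 2 ≤ n) {y : ℝ} (hy : 0 < y) :
    -Real.log y ≤ (1 - y) + 4 * Real.log n * (1 - y) ^ 2 + y⁻¹ / n := by
  have hL := half_le_log_natCast hn
  have hn0 : (0 : ℝ) < n := by positivity
  have hyn : 0 < y⁻¹ / n := by positivity
  rcases le_or_gt (1 / 2) y with h | h
  · have h1 := Real.log_le_sub_one_of_pos (inv_pos.mpr hy)
    rw [Real.log_inv] at h1
    have h2 : y⁻¹ - 1 = (1 - y) + (1 - y) ^ 2 * y⁻¹ := by field_simp; ring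
    have h3 : y⁻¹ ≤ 2 := by
      rw [inv_le_comm₀ hy two_pos]; linarith
    nlinarith [mul_le_mul_of_nonneg_left h3 (sq_nonneg (1 - y)),
      mul_le_mul_of_nonneg_right hL (sq_nonneg (1 - y))]
  · have h1 := Real.log_le_sub_one_of_pos hyn
    rw [Real.log_div (inv_pos.mpr hy).ne' hn0.ne', Real.log_inv] at h1
    have h2 : 1 / 4 ≤ (1 - y) ^ 2 := by nlinarith
    nlinarith [mul_le_mul_of_nonneg_left h2 (show 0 ≤ Real.log n by linarith)]

theorem neg_integral_log_le (h2 : Integrable (fun x : ℝ => x ^ 2) ν) (hm2 : ∫ x, x ^ 2 ∂ν = 1)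
    (h4 : Integrable (fun x : ℝ => x ^ 4) ν) (h : ∫⁻ x : ℝ, (‖x‖ₑ ^ 2)⁻¹ ∂ν < ⊤) {n : ℕ}
    (hn : 2 ≤ n) :
    -(2 * ∫ x, Real.log x ∂ν)
      ≤ 4 * Real.log n * (∫ x, x ^ 4 ∂ν - 1) + (∫⁻ x : ℝ, (‖x‖ₑ ^ 2)⁻¹ ∂ν).toReal / n := by
  have hlog := integrable_log h2 h
  have hinv := integrable_inv_sq h
  have i1 : Integrable (fun x : ℝ => 1 - x ^ 2) ν := (integrable_const _).sub h2
  have i2 : Integrable (fun x : ℝ => x ^ 4 - 2 * x ^ 2 + 1) ν :=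
    (h4.sub (h2.const_mul _)).add (integrable_const _)
  have i3 : Integrable (fun x : ℝ => (1 - x ^ 2) + 4 * Real.log n * (x ^ 4 - 2 * x ^ 2 + 1)) ν :=
    i1.add (i2.const_mul _)
  have hle : ∫ x, -(2 * Real.log x) ∂ν
      ≤ ∫ x, ((1 - x ^ 2) + 4 * Real.log n * (x ^ 4 - 2 * x ^ 2 + 1) + (x ^ 2)⁻¹ / n) ∂ν := by
    refine integral_mono_ae (hlog.const_mul 2).neg (i3.add (hinv.div_const _)) ?_
    filter_upwards [ae_ne_zero_of_lintegral_inv_sq h] with x hx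
    have h1 := neg_log_le hn (show 0 < x ^ 2 by positivity)
    rw [Real.log_pow] at h1
    push_cast at h1
    have h3 : (1 - x ^ 2) ^ 2 = x ^ 4 - 2 * x ^ 2 + 1 := by ring
    rwa [h3] at h1
  have e1 : ∫ x, (1 - x ^ 2) ∂ν = 0 := by
    rw [integral_sub (integrable_const _) h2, hm2]; simp
  have i4 : Integrable (fun x : ℝ => x ^ 4 - 2 * x ^ 2) ν := h4.sub (h2.const_mul _)
  have e2 : ∫ x, (x ^ 4 - 2 * x ^ 2 + 1) ∂ν = ∫ x, x ^ 4 ∂ν - 1 := by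
    rw [integral_add i4 (integrable_const _), integral_sub h4 (h2.const_mul _),
      integral_const_mul, hm2]
    simp
    ring
  rw [integral_add i3 (hinv.div_const _), integral_add i1 (i2.const_mul _), integral_const_mul,
    integral_div, e1, e2, integral_inv_sq h, integral_neg, integral_const_mul, zero_add] at hle
  exact hle

end Entropy

/-! ### Moments after rescaling, and the theorem -/

section CentralLimit

variable {μ : Measure ℝ} [IsProbabilityMeasure μ]

theorem booleanCLT_spec (hsymm : μ.map (fun x : ℝ => -x) = μ)
    (hm2i : Integrable (fun x : ℝ => x ^ 2) μ) (hm2 : ∫ x : ℝ, x ^ 2 ∂μ = 1)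
    (hm4 : Integrable (fun x : ℝ => x ^ 4) μ)
    (hmneg2 : ∫⁻ x : ℝ, (‖x‖ₑ ^ 2)⁻¹ ∂μ < ⊤) {n : ℕ} (hn : 1 ≤ n) :
    IsProbabilityMeasure (booleanCLT μ n) ∧
      (Integrable (fun x : ℝ => x ^ 2) (booleanCLT μ n) ∧ ∫ x : ℝ, x ^ 2 ∂(booleanCLT μ n) = 1) ∧
      (Integrable (fun x : ℝ => x ^ 4) (booleanCLT μ n) ∧
        ∫ x : ℝ, x ^ 4 ∂(booleanCLT μ n) = 1 + (∫ x : ℝ, x ^ 4 ∂μ - 1) / n) ∧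
      ∫⁻ x : ℝ, (‖x‖ₑ ^ 2)⁻¹ ∂(booleanCLT μ n) = ∫⁻ x : ℝ, (‖x‖ₑ ^ 2)⁻¹ ∂μ := by
  obtain ⟨hprob, hK⟩ := booleanPow_spec hsymm n
  obtain ⟨h2i, h2⟩ := moment_two_of_selfEnergy hsymm hm2i hm2 hn hK
  obtain ⟨h4i, h4⟩ := moment_four_of_selfEnergy hsymm hm2i hm2 hm4 hn hK
  have hinv := inv_moment_of_selfEnergy hsymm hmneg2 hn hK
  have hn0 : (0 : ℝ) < n := by exact_mod_cast hn
  have hmeas : Measurable (fun x : ℝ => 1 / √(n : ℝ) * x) := by fun_prop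
  have hsq : (1 / √(n : ℝ)) ^ 2 = (n : ℝ)⁻¹ := by
    rw [div_pow, Real.sq_sqrt hn0.le, one_pow, one_div]
  have hp2 : ∀ x : ℝ, (1 / √(n : ℝ) * x) ^ 2 = (n : ℝ)⁻¹ * x ^ 2 := fun x => by
    rw [mul_pow, hsq]
  have hp4 : ∀ x : ℝ, (1 / √(n : ℝ) * x) ^ 4 = ((n : ℝ)⁻¹) ^ 2 * x ^ 4 := fun x => by
    rw [← hsq]; ring
  unfold booleanCLT
  refine ⟨Measure.isProbabilityMeasure_map hmeas.aemeasurable, ⟨?_, ?_⟩, ⟨?_, ?_⟩, ?_⟩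
  · rw [integrable_map_measure (Measurable.aestronglyMeasurable (by fun_prop)) hmeas.aemeasurable]
    simp only [Function.comp_def, hp2]
    exact h2i.const_mul _
  · rw [integral_map hmeas.aemeasurable (Measurable.aestronglyMeasurable (by fun_prop))]
    simp only [hp2]
    rw [integral_const_mul, h2, inv_mul_cancel₀ hn0.ne']
  · rw [integrable_map_measure (Measurable.aestronglyMeasurable (by fun_prop)) hmeas.aemeasurable]
    simp only [Function.comp_def, hp4]
    exact h4i.const_mul _
  · rw [integral_map hmeas.aemeasurable (Measurable.aestronglyMeasurable (by fun_prop))]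
    simp only [hp4]
    rw [integral_const_mul, h4]
    field_simp
    ring
  -- The dilation multiplies the inverse second moment by `n`, cancelling the `1/n` of the Boolean
  -- power.
  · rw [lintegral_map (by fun_prop) hmeas]
    have : ∀ x : ℝ, (‖1 / √(n : ℝ) * x‖ₑ ^ 2)⁻¹ = ENNReal.ofReal n * (‖x‖ₑ ^ 2)⁻¹ := by
      intro x
      have hc : ‖1 / √(n : ℝ)‖ₑ ^ 2 = (ENNReal.ofReal n)⁻¹ := by
        rw [enorm_sq_eq_ofReal, hsq, ENNReal.ofReal_inv_of_pos hn0]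
      rw [enorm_mul, mul_pow, hc, ENNReal.mul_inv (by left; simp) (by left; simp; omega),
        inv_inv]
    simp_rw [this]
    rw [lintegral_const_mul _ (by fun_prop), hinv, ← ENNReal.ofReal_mul hn0.le,
      mul_div_cancel₀ _ hn0.ne', ENNReal.ofReal_toReal hmneg2.ne]

end CentralLimit

end BooleanProb

theorem mainTheorem11 (μ : Measure ℝ) [IsProbabilityMeasure μ]
    (hsymm : μ.map (fun x : ℝ => -x) = μ)
    (hm2 : ∫ x : ℝ, x ^ 2 ∂μ = 1)
    (hm4 : Integrable (fun x : ℝ => x ^ 4) μ)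
    (hmneg2 : ∫⁻ x : ℝ, (‖x‖ₑ ^ 2)⁻¹ ∂μ < ⊤) :
    (∀ n : ℕ, 1 ≤ n →
      0 ≤ BooleanProb.relBooleanEntropy (BooleanProb.booleanCLT μ n) ∧
        BooleanProb.relBooleanEntropy (BooleanProb.booleanCLT μ n) < ⊤) ∧
    (fun n : ℕ => (BooleanProb.relBooleanEntropy (BooleanProb.booleanCLT μ n)).toReal)
      =O[atTop] (fun n : ℕ => Real.log (n : ℝ) / (n : ℝ)) := by
  -- A non-integrable function has integral `0` by convention, so the value `1` forces
  -- integrability.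
  have hm2i : Integrable (fun x : ℝ => x ^ 2) μ := by
    by_contra h
    rw [integral_undef h] at hm2
    exact zero_ne_one hm2
  have hspec := fun (n : ℕ) (hn : 1 ≤ n) =>
    BooleanProb.booleanCLT_spec hsymm hm2i hm2 hm4 hmneg2 hn
  refine ⟨fun n hn => ?_, ?_⟩
  · obtain ⟨_, ⟨h2i, -⟩, -, hinv⟩ := hspec n hn
    have hfin := hinv.trans_lt hmneg2
    rw [BooleanProb.relBooleanEntropy_eq_integral h2i hfin]
    refine ⟨?_, EReal.coe_lt_top _⟩
    have := BooleanProb.integral_log_le h2i hfin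
    exact_mod_cast (by linarith : (0 : ℝ) ≤ 1 / 2 * _ - _ - 1 / 2)
  · set M := (∫⁻ x : ℝ, (‖x‖ₑ ^ 2)⁻¹ ∂μ).toReal with hM
    -- The bound is `2 log n (m₄ - 1)/n + M/(2n)`; for `n ≥ 2` the last term is absorbed through
    -- `1/2 ≤ log n`.
    refine IsBigO.of_bound (2 * (∫ x : ℝ, x ^ 4 ∂μ - 1) + M) ?_
    filter_upwards [eventually_ge_atTop 2] with n hn
    obtain ⟨_, ⟨h2i, h2⟩, ⟨h4i, h4⟩, hinv⟩ := hspec n (by omega)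
    have hfin := hinv.trans_lt hmneg2
    have hlow := BooleanProb.integral_log_le h2i hfin
    have hup := BooleanProb.neg_integral_log_le h2i h2 h4i hfin hn
    rw [BooleanProb.relBooleanEntropy_eq_integral h2i hfin, EReal.toReal_coe]
    rw [h2] at hlow ⊢
    rw [h4, hinv, ← hM] at hup
    have hL := BooleanProb.half_le_log_natCast hn
    have hn0 : (0 : ℝ) < n := by positivity
    rw [Real.norm_of_nonneg (by linarith), Real.norm_of_nonneg (by positivity)]
    have hM0 : 0 ≤ M / n := by positivity
    have h5 : (2 * (∫ x : ℝ, x ^ 4 ∂μ - 1) + M) * (Real.log n / n)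
        = 1 / 2 * (4 * Real.log n * (1 + (∫ x : ℝ, x ^ 4 ∂μ - 1) / n - 1)) + M / n * Real.log n := by
      ring
    rw [h5]
    nlinarith [mul_le_mul_of_nonneg_left hL hM0]
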